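/- **Setting.** Let $X_1,\dots,X_N$ be IID real random variables with distribution $P$ and distribution function $F$. Let $\gamma\in(0,1)$ and let $\theta(P)=\inf\{t: F(t)\ge\gamma\}$ be the $\gamma$-quantile. The data are split into two disjoint parts $D_1=\{X_i:i\in I_1\}$ and $D_2=\{X_i:i\in I_2\}$ with $I_1\cup I_2=\{1,\dots,N\}$ and $n=|D_2|$. The initial estimator $\widehat\theta_1$ is a measurable function of $D_1$. Write $m_\theta(x)=\gamma(x-\theta)_++(1-\gamma)(\theta-x)_+$, let $\mathbb P_n$ be the empirical mean over $D_2$, let $\widehat\sigma_{\theta,\theta'}$ be the sample standard deviation (normalization $n-1$) of $m_\theta-m_{\theta'}$ over $D_2$, and let $z_\alpha$ be the $(1-\alpha)$-quantile of the standard normal law. For $\alpha\in(0,1)$, the CLT-based confidence set is $$\widehat{\mathrm{CI}}^\gamma_{n,\alpha}=\{\theta\in\mathbb R:\ \mathbb P_n(m_\theta-m_{\widehat\theta_1})\le n^{-1/2}z_\alpha\,\widehat\sigma_{\theta,\widehat\theta_1}\}.$$ **Assumption.** Let $\beta>0$, $0<M_1<M_0$, $\delta>0$, and assume that for all $\theta$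 with $|\theta-\theta(P)|\le\delta$, $$\big|F(\theta)-F(\theta(P))-M_0|\theta-\theta(P)|^\beta\,\mathrm{sgn}(\theta-\theta(P))\big|\le M_1|\theta-\theta(P)|^\beta .$$ **Theorem.** Let $\varepsilon>0$. Constants below never depend on $\gamma$, nor on $P$ except through the quantities listed. 1. There are constants $\mathfrak C,C_1,C_2>0$ depending only on $\varepsilon,\alpha,\beta,M_0,M_1$ such that the following holds. Let $s_n$ be any random variable with, almost surely, $$n^{-1/2}\sqrt{P(m_{\widehat\theta_1}-m_{\theta(P)})^2}+P(m_{\widehat\theta_1}-m_{\theta(P)})\le s_n ,$$ where $P$ integrates over a new observation with $\widehat\theta_1$ held fixed. If $n\ge C_1\delta^{-2\beta}$, then $\mathbb P\big(\mathrm{Diam}(\widehat{\mathrm{CI}}^\gamma_{n,\alpha})\le\mathfrak C\,\tau_n\big)\ge1-\varepsilon$, where $$\tau_n=\big(n^{-1/(2\beta)}+s_n^{1/(1+\beta)}\big)\,\mathbb P\big(|\widehat\theta_1-\theta(P)|<C_2\delta^{1+\beta}\big)+\delta^{-\beta}\,\mathbb E\big[|\widehat\theta_1-\theta(P)|\,\mathbf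 1\{|\widehat\theta_1-\theta(P)|\ge C_2\delta^{1+\beta}\}\big]\in[0,\infty].$$ 2. Let $\varepsilon'\mapsto C_{\varepsilon'}$ be a function on $(0,\infty)$. There is $\mathfrak C>0$ depending only on $\varepsilon,\alpha,\beta,M_0,M_1$ and this function, and for each $\delta>0$ an integer $n_0$ depending in addition only on $\delta$, such that if $n\ge n_0$ and $\mathbb P\big(|\widehat\theta_1-\theta(P)|^2\le C_{\varepsilon'}n^{-1/\beta}\big)\ge1-\varepsilon'$ for every $\varepsilon'>0$, then $$\mathbb P\big(\mathrm{Diam}(\widehat{\mathrm{CI}}^\gamma_{n,\alpha})\le\mathfrak C\,n^{-1/(2\beta)}\big)\ge1-\varepsilon .$$ 3. In particular the last bound holds for the sample quantile. For every $\kappa>0$ there is $\mathfrak C>0$ depending only on $\varepsilon,\alpha,\beta,M_0,M_1,\kappa$, and for each $\delta>0$ an integer $n_0$ depending in addition only on $\delta$, such that if $|D_1|\ge\kappa n$, $n\ge n_0$ and $\widehat\theta_1$ is the sample $\gamma$-quantile $\inf\{t:F_{D_1}(t)\ge\gamma\}$ of $D_1$ (with $F_{D_1}$ its empirical distribution function),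 then $\mathbb P\big(\mathrm{Diam}(\widehat{\mathrm{CI}}^\gamma_{n,\alpha})\le\mathfrak C\,n^{-1/(2\beta)}\big)\ge1-\varepsilon$. The confidence set is defined without knowledge of $\beta$, $\delta$, $M_0$, $M_1$. -/

import Mathlib

open MeasureTheory ProbabilityTheory

noncomputable section

namespace QuantileCI

/-- The `γ`-quantile `inf {t : F_P(t) ≥ γ}` of a distribution `P` on the line. -/
def quantile (P : Measure ℝ) (γ : ℝ) : ℝ :=
  sInf {t : ℝ | γ ≤ cdf P t}

/-- The quantile loss `m_θ(x) = γ (x - θ)₊ + (1 - γ) (θ - x)₊`. -/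
def loss (γ θ x : ℝ) : ℝ :=
  γ * max (x - θ) 0 + (1 - γ) * max (θ - x) 0

/-- The loss difference `(m_θ - m_θ')(x)`. It is bounded in `x`, by `|θ - θ'|` for `γ ∈ (0, 1)`. -/
def lossDiff (γ θ θ' x : ℝ) : ℝ :=
  loss γ θ x - loss γ θ' x

/-- The critical value `z_α`: the `(1 - α)`-quantile of the standard normal distribution. -/
def normalCritical (α : ℝ) : ℝ :=
  quantile (gaussianReal 0 1) (1 - α)

/-- The empirical mean of `f` over the sample `x`. -/
def empMean {ι : Type*} [Fintype ι] (x : ι → ℝ) (f : ℝ → ℝ) : ℝ :=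
  (∑ i, f (x i)) / (Fintype.card ι : ℝ)

/-- The sample standard deviation of `f` over the sample `x` (normalization `n - 1`). -/
def sampleSD {ι : Type*} [Fintype ι] (x : ι → ℝ) (f : ℝ → ℝ) : ℝ :=
  Real.sqrt ((∑ i, (f (x i) - empMean x f) ^ 2) / ((Fintype.card ι : ℝ) - 1))

/-- The CLT-based confidence set for the `γ`-quantile at level `α`, computed from the sample `x`
and the value `θ₁` of the initial estimator. -/
def cltSet {ι : Type*} [Fintype ι] (γ α θ₁ : ℝ) (x : ι → ℝ) : Set ℝ :=
  {θ : ℝ | empMean x (lossDiff γ θ θ₁) ≤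
    (Fintype.card ι : ℝ) ^ (-(1 / 2) : ℝ) * normalCritical α * sampleSD x (lossDiff γ θ θ₁)}

/-- The sample `γ`-quantile `inf {t : F_m(t) ≥ γ}`, with `F_m` the empirical distribution function
of the sample `x`. -/
def sampleQuantile {ι : Type*} [Fintype ι] (γ : ℝ) (x : ι → ℝ) : ℝ :=
  sInf {t : ℝ | γ ≤ empMean x (Set.indicator (Set.Iic t) 1)}

/-- Local Hölder behaviour of order `β` of the distribution function around the `γ`-quantile. -/
def HolderAtQuantile (P : Measure ℝ) (γ β δ M₀ M₁ : ℝ) : Prop :=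
  ∀ θ : ℝ, |θ - quantile P γ| ≤ δ →
    |cdf P θ - cdf P (quantile P γ)
        - M₀ * |θ - quantile P γ| ^ β * Real.sign (θ - quantile P γ)|
      ≤ M₁ * |θ - quantile P γ| ^ β

/-- `n^{-1/2} √(P (m_θ - m_{θ(P)})²) + P (m_θ - m_{θ(P)})`, the accuracy of a (fixed) value `θ`
of the initial estimator. -/
def initialError (P : Measure ℝ) (γ : ℝ) (n : ℕ) (θ : ℝ) : ℝ :=
  (n : ℝ) ^ (-(1 / 2) : ℝ) * Real.sqrt (∫ x, lossDiff γ θ (quantile P γ) x ^ 2 ∂P)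
    + ∫ x, lossDiff γ θ (quantile P γ) x ∂P

/-- The observations `X i` are independent with common distribution `P`. -/
structure IsIIDSample {Ω : Type*} [MeasurableSpace Ω] {N : ℕ} (X : Fin N → Ω → ℝ)
    (P : Measure ℝ) (μ : Measure Ω) : Prop where
  measurable : ∀ i, Measurable (X i)
  law : ∀ i, μ.map (X i) = P
  indep : iIndepFun X μ

/-- The part of the data with indices in `I`. -/
def subsample {Ω : Type*} {N : ℕ} (X : Fin N → Ω → ℝ) (I : Finset (Fin N)) (ω : Ω) : I → ℝ :=
  fun i => X i ω

/-- The width bound `τ_n`, where `θ₁` is the initial estimator, `θ₀` the quantile and `sω` the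
realized value of `s_n`:
`(n^{-1/(2β)} + s_n^{1/(1+β)}) ℙ(|θ₁ - θ₀| < C₂ δ^{1+β})
  + δ^{-β} 𝔼[|θ₁ - θ₀| 1{|θ₁ - θ₀| ≥ C₂ δ^{1+β}}]`.
It takes values in `[0, ∞]`, since the expectation may be infinite. -/
def widthBound {Ω : Type*} [MeasurableSpace Ω] (μ : Measure Ω) (θ₁ : Ω → ℝ)
    (θ₀ β δ C₂ : ℝ) (n : ℕ) (sω : ℝ) : ENNReal :=
  ENNReal.ofReal ((n : ℝ) ^ (-(1 / (2 * β))) + sω ^ (1 / (1 + β)))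
      * μ {ω | |θ₁ ω - θ₀| < C₂ * δ ^ (1 + β)}
    + ENNReal.ofReal (δ ^ (-β))
      * ∫⁻ ω in {ω | C₂ * δ ^ (1 + β) ≤ |θ₁ ω - θ₀|}, ENNReal.ofReal |θ₁ ω - θ₀| ∂μ

end QuantileCI

end

noncomputable section

namespace QuantileCI

/-! The empirical risk is convex in `θ`, so no uniform empirical-process bound is needed: a lower
bound `B` at the two points `θ₀ ± r` around the quantile `θ₀` forces growth at least `B |θ - θ₀| /
r` beyond them (`mul_le_empMean_lossDiff`). The population risk at `θ₀ ± r` is at least of order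
`r^{1+β}`, because its slope is `F - γ`, and by Chebyshev the noise there is of order `n^{-1/2} r`.
Conversely, membership in the confidence set bounds the empirical risk of `θ` by that of the initial
estimator plus `n^{-1/2}` times a term linear in `|θ - θ₀|`. Once `r^β` dominates `n^{-1/2}` the
linear term is absorbed, leaving `|θ - θ₀| ≲ max(r, s / r^β)` with `s` the error of the initial
estimator (`abs_sub_le_of_mem_cltSet`). Balancing gives `r ≍ n^{-1/(2β)} + s^{1/(1+β)}`. This radius
is random, but it depends on the first part of the data only, so by independence it is fixed for
Chebyshev on the second part (`exists_localization`). If the radius exceeds `δ`, truncating it at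
`δ` and using that the loss is Lipschitz gives a bound of order `δ^{-β} |θ̂₁ - θ₀|`, which Markov
turns into the expectation term of the width bound. An initial error of order `n^{-1/(2β)}` gives `s
≲ n^{-(1+β)/(2β)}`, hence a radius of the same order; the sample quantile has this accuracy. -/

/-! ### Pointwise bounds and convexity of the quantile loss. -/

lemma abs_lossDiff_le {γ : ℝ} (h0 : 0 < γ) (h1 : γ < 1) (θ θ' x : ℝ) :
    |lossDiff γ θ θ' x| ≤ |θ - θ'| := by
  unfold lossDiff loss
  rw [abs_le]
  rcases le_total x θ with h | h <;> rcases le_total x θ' with h' | h' <;>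
  rcases le_total θ θ' with h2 | h2 <;>
  simp [h, h', h2, abs_of_nonneg, abs_of_nonpos] <;> constructor <;> nlinarith

lemma lossDiff_sq_le {γ : ℝ} (h0 : 0 < γ) (h1 : γ < 1) (θ θ' x : ℝ) :
    lossDiff γ θ θ' x ^ 2 ≤ (θ - θ') ^ 2 :=
  sq_le_sq.mpr (abs_lossDiff_le h0 h1 θ θ' x)

/-- `1{x ≤ θ'} - γ` is a subgradient of `θ ↦ m_θ(x)` at `θ'`. Integrating it gives `F(θ') - γ`,
which is how the distribution function enters. -/
lemma subgradient_le_lossDiff (γ θ θ' x : ℝ) :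
    ((Set.Iic θ').indicator 1 x - γ) * (θ - θ') ≤ lossDiff γ θ θ' x := by
  unfold lossDiff loss
  by_cases h' : x ≤ θ'
  · rw [Set.indicator_of_mem (by simpa using h')]
    rcases le_total x θ with h | h <;> simp [h, h'] <;> nlinarith
  · rw [Set.indicator_of_notMem (by simpa using h')]
    have h' := (not_le.mp h').le
    rcases le_total x θ with h | h <;> simp [h, h'] <;> nlinarith

lemma convexOn_loss {γ : ℝ} (h0 : 0 < γ) (h1 : γ < 1) (x : ℝ) :
    ConvexOn ℝ Set.univ fun θ => loss γ θ x := by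
  have hid : ConvexOn ℝ Set.univ fun θ : ℝ => θ - x :=
    (convexOn_id convex_univ).sub (concaveOn_const x convex_univ)
  have hid' : ConvexOn ℝ Set.univ fun θ : ℝ => x - θ :=
    (convexOn_const x convex_univ).sub (concaveOn_id convex_univ)
  have hz : ConvexOn ℝ Set.univ fun _ : ℝ => (0 : ℝ) := convexOn_const 0 convex_univ
  exact ((hid'.sup hz).smul h0.le).add ((hid.sup hz).smul (sub_pos.mpr h1).le)

/-- Convexity along the segment from `θ₀`, where the difference vanishes. -/
lemma lossDiff_segment_le {γ : ℝ} (h0 : 0 < γ) (h1 : γ < 1) (θ θ₀ x : ℝ) {t : ℝ}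
    (ht0 : 0 ≤ t) (ht1 : t ≤ 1) :
    lossDiff γ (θ₀ + t * (θ - θ₀)) θ₀ x ≤ t * lossDiff γ θ θ₀ x := by
  have h := (convexOn_loss h0 h1 x).2 (Set.mem_univ θ₀) (Set.mem_univ θ)
    (sub_nonneg.mpr ht1) ht0 (by ring)
  simp only [smul_eq_mul] at h
  rw [show (1 - t) * θ₀ + t * θ = θ₀ + t * (θ - θ₀) by ring] at h
  unfold lossDiff
  linarith

lemma continuous_lossDiff (γ : ℝ) :
    Continuous fun p : ℝ × ℝ × ℝ => lossDiff γ p.1 p.2.1 p.2.2 := by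
  unfold lossDiff loss
  fun_prop

@[fun_prop]
lemma measurable_lossDiff_comp {E : Type*} [MeasurableSpace E] (γ : ℝ) {a b c : E → ℝ}
    (ha : Measurable a) (hb : Measurable b) (hc : Measurable c) :
    Measurable fun e => lossDiff γ (a e) (b e) (c e) :=
  (continuous_lossDiff γ).measurable.comp (ha.prodMk (hb.prodMk hc))

lemma lossDiff_sub (γ θ θ₁ θ₀ x : ℝ) :
    lossDiff γ θ θ₁ x = lossDiff γ θ θ₀ x - lossDiff γ θ₁ θ₀ x := by
  unfold lossDiff; ring

/-! ### The population risk near the quantile. -/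

section Risk

variable {P : Measure ℝ} {γ β δ M₀ M₁ : ℝ}

lemma le_cdf_of_quantile_lt (h1 : γ < 1) {t : ℝ} (ht : quantile P γ < t) : γ ≤ cdf P t := by
  have hne : {t : ℝ | γ ≤ cdf P t}.Nonempty :=
    (((tendsto_cdf_atTop P).eventually_const_le h1)).exists
  obtain ⟨s, hs, hst⟩ := exists_lt_of_csInf_lt hne ht
  exact le_trans hs (monotone_cdf P hst.le)

lemma HolderAtQuantile.right (h : HolderAtQuantile P γ β δ M₀ M₁) {t : ℝ} (ht : 0 < t)
    (htδ : t ≤ δ) :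
    (M₀ - M₁) * t ^ β ≤ cdf P (quantile P γ + t) - cdf P (quantile P γ) ∧
      cdf P (quantile P γ + t) - cdf P (quantile P γ) ≤ (M₀ + M₁) * t ^ β := by
  have := h (quantile P γ + t) (by simpa [abs_of_pos ht] using htδ)
  simp only [add_sub_cancel_left, abs_of_pos ht, Real.sign_of_pos ht, abs_le] at this
  constructor <;> nlinarith [this.1, this.2]

lemma HolderAtQuantile.left (h : HolderAtQuantile P γ β δ M₀ M₁) {t : ℝ} (ht : 0 < t)
    (htδ : t ≤ δ) :
    (M₀ - M₁) * t ^ β ≤ cdf P (quantile P γ) - cdf P (quantile P γ - t) ∧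
      cdf P (quantile P γ) - cdf P (quantile P γ - t) ≤ (M₀ + M₁) * t ^ β := by
  have := h (quantile P γ - t) (by simpa [abs_of_pos ht] using htδ)
  simp only [sub_sub_cancel_left, abs_neg, abs_of_pos ht,
    Real.sign_of_neg (neg_lt_zero.mpr ht), abs_le] at this
  constructor <;> nlinarith [this.1, this.2]

lemma cdf_lt_of_lt_quantile (h0 : 0 < γ) {t : ℝ} (ht : t < quantile P γ) : cdf P t < γ := by
  by_contra! h
  refine absurd (csInf_le (s := {t : ℝ | γ ≤ cdf P t}) ?_ h) (not_le.mpr ht)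
  obtain ⟨b, hb⟩ := ((tendsto_cdf_atBot P).eventually_lt_const h0).exists
  refine ⟨b, fun s (hs : γ ≤ cdf P s) => ?_⟩
  by_contra! hlt
  exact absurd (hs.trans (monotone_cdf P hlt.le)) (not_le.mpr hb)

/-- The Hölder bound excludes an atom at the quantile: `F(θ₀ - t) < γ ≤ F(θ₀ + t)`, while both
increments are at most `(M₀ + M₁) t^β → 0`. -/
lemma HolderAtQuantile.cdf_quantile (h : HolderAtQuantile P γ β δ M₀ M₁) (h0 : 0 < γ)
    (h1 : γ < 1) (hβ : 0 < β) (hδ : 0 < δ) : cdf P (quantile P γ) = γ := by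
  have hlim : Filter.Tendsto (fun t : ℝ => (M₀ + M₁) * t ^ β) (nhdsWithin 0 (Set.Ioi 0))
      (nhds 0) := by
    have : Filter.Tendsto (fun t : ℝ => (M₀ + M₁) * t ^ β) (nhds 0) (nhds 0) := by
      have := ((Real.continuous_rpow_const hβ.le).tendsto 0).const_mul (M₀ + M₁)
      simpa [Real.zero_rpow hβ.ne'] using this
    exact this.mono_left nhdsWithin_le_nhds
  have hev : ∀ᶠ t in nhdsWithin (0 : ℝ) (Set.Ioi 0), 0 < t ∧ t ≤ δ :=
    Ioc_mem_nhdsGT hδ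
  apply le_antisymm
  · have := ge_of_tendsto (hlim) (b := cdf P (quantile P γ) - γ) (by
      filter_upwards [hev] with t ht
      have h2 := (h.left ht.1 ht.2).2
      have h3 := cdf_lt_of_lt_quantile (P := P) h0 (sub_lt_self (quantile P γ) ht.1)
      linarith)
    linarith
  · have := ge_of_tendsto (hlim) (b := γ - cdf P (quantile P γ)) (by
      filter_upwards [hev] with t ht
      have h2 := (h.right ht.1 ht.2).2
      have h3 := le_cdf_of_quantile_lt (P := P) h1 (lt_add_of_pos_right (quantile P γ) ht.1)
      linarith)
    linarith

/-- An increment of `F` is at most one. This bounds `δ`, so that a sample size of order `δ^{-2β}` is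
at least 2. -/
lemma HolderAtQuantile.mul_rpow_le_one (h : HolderAtQuantile P γ β δ M₀ M₁) (hδ : 0 < δ) :
    (M₀ - M₁) * δ ^ β ≤ 1 := by
  have := (h.right hδ le_rfl).1
  have h1 := cdf_le_one P (quantile P γ + δ)
  have h2 := cdf_nonneg P (quantile P γ)
  linarith

variable [IsProbabilityMeasure P]

lemma integrable_lossDiff (h0 : 0 < γ) (h1 : γ < 1) (θ θ' : ℝ) :
    Integrable (lossDiff γ θ θ') P := by
  refine Integrable.of_bound (C := |θ - θ'|) ?_ (ae_of_all _ fun x => ?_)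
  · exact (measurable_lossDiff_comp γ measurable_const measurable_const
      measurable_id).aestronglyMeasurable
  · exact abs_lossDiff_le h0 h1 θ θ' x

lemma integrable_lossDiff_sq (h0 : 0 < γ) (h1 : γ < 1) (θ θ' : ℝ) :
    Integrable (fun x => lossDiff γ θ θ' x ^ 2) P := by
  refine Integrable.of_bound (C := (θ - θ') ^ 2) ?_ (ae_of_all _ fun x => ?_)
  · exact ((measurable_lossDiff_comp γ measurable_const measurable_const
      measurable_id).pow_const 2).aestronglyMeasurable
  · rw [Real.norm_eq_abs, abs_of_nonneg (sq_nonneg _)]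
    exact lossDiff_sq_le h0 h1 θ θ' x

lemma integral_lossDiff_sq_le (h0 : 0 < γ) (h1 : γ < 1) (θ θ' : ℝ) :
    ∫ x, lossDiff γ θ θ' x ^ 2 ∂P ≤ (θ - θ') ^ 2 := by
  calc _ ≤ ∫ _, (θ - θ') ^ 2 ∂P := integral_mono (integrable_lossDiff_sq h0 h1 θ θ')
        (integrable_const _) (lossDiff_sq_le h0 h1 θ θ')
    _ = _ := by simp

lemma integral_lossDiff_le (h0 : 0 < γ) (h1 : γ < 1) (θ θ' : ℝ) :
    ∫ x, lossDiff γ θ θ' x ∂P ≤ |θ - θ'| := by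
  calc _ ≤ ∫ _, |θ - θ'| ∂P := integral_mono (integrable_lossDiff h0 h1 θ θ')
        (integrable_const _) fun x => (le_abs_self _).trans (abs_lossDiff_le h0 h1 θ θ' x)
    _ = _ := by simp

lemma subgradient_le_integral_lossDiff (h0 : 0 < γ) (h1 : γ < 1) (θ θ' : ℝ) :
    (cdf P θ' - γ) * (θ - θ') ≤ ∫ x, lossDiff γ θ θ' x ∂P := by
  have hi : Integrable ((Set.Iic θ').indicator (1 : ℝ → ℝ)) P :=
    (integrable_const (1 : ℝ)).indicator measurableSet_Iic
  have h : ∫ x, ((Set.Iic θ').indicator 1 x - γ) * (θ - θ') ∂P = (cdf P θ' - γ) * (θ - θ') := by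
    rw [integral_mul_const, integral_sub hi (integrable_const _),
      integral_indicator_one measurableSet_Iic, cdf_eq_real]
    simp
  rw [← h]
  exact integral_mono ((hi.sub (integrable_const _)).mul_const _)
    (integrable_lossDiff h0 h1 θ θ') (subgradient_le_lossDiff γ θ θ')

lemma HolderAtQuantile.integral_lossDiff_nonneg (h : HolderAtQuantile P γ β δ M₀ M₁)
    (h0 : 0 < γ) (h1 : γ < 1) (hβ : 0 < β) (hδ : 0 < δ) (θ : ℝ) :
    0 ≤ ∫ x, lossDiff γ θ (quantile P γ) x ∂P := by
  have := subgradient_le_integral_lossDiff (P := P) h0 h1 θ (quantile P γ)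
  rwa [h.cdf_quantile h0 h1 hβ hδ, sub_self, zero_mul] at this

/-- The subgradient inequality at `θ`, tested at the quantile, bounds the risk by `(F(θ) - γ)(θ -
θ₀)`. -/
lemma HolderAtQuantile.integral_lossDiff_le (h : HolderAtQuantile P γ β δ M₀ M₁)
    (h0 : 0 < γ) (h1 : γ < 1) (hβ : 0 < β) (hδ : 0 < δ) {θ : ℝ}
    (hθ : |θ - quantile P γ| ≤ δ) :
    ∫ x, lossDiff γ θ (quantile P γ) x ∂P ≤ (M₀ + M₁) * |θ - quantile P γ| ^ (1 + β) := by
  have hs := subgradient_le_integral_lossDiff (P := P) h0 h1 (quantile P γ) θ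
  have heq : ∫ x, lossDiff γ (quantile P γ) θ x ∂P
      = -∫ x, lossDiff γ θ (quantile P γ) x ∂P := by
    rw [← integral_neg]; congr 1; ext x; unfold lossDiff; ring
  rw [heq] at hs
  have hq := h.cdf_quantile h0 h1 hβ hδ
  rcases lt_trichotomy θ (quantile P γ) with hlt | rfl | hgt
  · have ht : 0 < quantile P γ - θ := by linarith
    rw [abs_sub_comm, abs_of_pos ht] at hθ ⊢
    have := (h.left ht hθ).2
    rw [hq, sub_sub_cancel] at this
    rw [Real.rpow_add ht, Real.rpow_one]
    nlinarith
  · simp [lossDiff, Real.zero_rpow (by linarith : (1 + β) ≠ 0)]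
  · have ht : 0 < θ - quantile P γ := by linarith
    rw [abs_of_pos ht] at hθ ⊢
    have := (h.right ht hθ).2
    rw [hq, add_sub_cancel] at this
    rw [Real.rpow_add ht, Real.rpow_one]
    nlinarith

lemma integral_lossDiff_add (h0 : 0 < γ) (h1 : γ < 1) (θ θ' θ'' : ℝ) :
    ∫ x, lossDiff γ θ θ'' x ∂P
      = ∫ x, lossDiff γ θ θ' x ∂P + ∫ x, lossDiff γ θ' θ'' x ∂P := by
  rw [← integral_add (integrable_lossDiff h0 h1 _ _) (integrable_lossDiff h0 h1 _ _)]
  congr 1; ext x; unfold lossDiff; ring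

/-- Splitting at the midpoint avoids integrating `t^β`: the risk is nonnegative at `θ₀ + r/2`, and
from there on its slope is at least `F(θ₀ + r/2) - γ`. -/
lemma HolderAtQuantile.le_integral_lossDiff_right (h : HolderAtQuantile P γ β δ M₀ M₁)
    (h0 : 0 < γ) (h1 : γ < 1) (hβ : 0 < β) {r : ℝ} (hr : 0 < r) (hrδ : r ≤ δ) :
    (M₀ - M₁) * (r / 2) ^ β * (r / 2)
      ≤ ∫ x, lossDiff γ (quantile P γ + r) (quantile P γ) x ∂P := by
  have hδ := hr.trans_le hrδ
  rw [integral_lossDiff_add h0 h1 _ (quantile P γ + r / 2)]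
  have ha := h.integral_lossDiff_nonneg h0 h1 hβ hδ (quantile P γ + r / 2)
  have hb := subgradient_le_integral_lossDiff (P := P) h0 h1 (quantile P γ + r)
    (quantile P γ + r / 2)
  have hc := (h.right (half_pos hr) (by linarith)).1
  rw [h.cdf_quantile h0 h1 hβ hδ] at hc
  nlinarith

lemma HolderAtQuantile.le_integral_lossDiff_left (h : HolderAtQuantile P γ β δ M₀ M₁)
    (h0 : 0 < γ) (h1 : γ < 1) (hβ : 0 < β) {r : ℝ} (hr : 0 < r) (hrδ : r ≤ δ) :
    (M₀ - M₁) * (r / 2) ^ β * (r / 2)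
      ≤ ∫ x, lossDiff γ (quantile P γ - r) (quantile P γ) x ∂P := by
  have hδ := hr.trans_le hrδ
  rw [integral_lossDiff_add h0 h1 _ (quantile P γ - r / 2)]
  have ha := h.integral_lossDiff_nonneg h0 h1 hβ hδ (quantile P γ - r / 2)
  have hb := subgradient_le_integral_lossDiff (P := P) h0 h1 (quantile P γ - r)
    (quantile P γ - r / 2)
  have hc := (h.left (half_pos hr) (by linarith)).1
  rw [h.cdf_quantile h0 h1 hβ hδ] at hc
  nlinarith

lemma HolderAtQuantile.initialError_nonneg (h : HolderAtQuantile P γ β δ M₀ M₁)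
    (h0 : 0 < γ) (h1 : γ < 1) (hβ : 0 < β) (hδ : 0 < δ) (n : ℕ) (θ : ℝ) :
    0 ≤ initialError P γ n θ :=
  add_nonneg (by positivity) (h.integral_lossDiff_nonneg h0 h1 hβ hδ θ)

lemma measurable_integral_lossDiff (θ₀ : ℝ) :
    Measurable fun θ => ∫ x, lossDiff γ θ θ₀ x ∂P :=
  (Measurable.stronglyMeasurable (by fun_prop :
    Measurable (Function.uncurry fun θ x => lossDiff γ θ θ₀ x))).integral_prod_right.measurable

lemma measurable_integral_lossDiff_sq (θ₀ : ℝ) :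
    Measurable fun θ => ∫ x, lossDiff γ θ θ₀ x ^ 2 ∂P :=
  (Measurable.stronglyMeasurable (by fun_prop :
    Measurable (Function.uncurry fun θ x => lossDiff γ θ θ₀ x ^ 2))).integral_prod_right.measurable

lemma measurable_initialError (n : ℕ) : Measurable (initialError P γ n) :=
  ((measurable_integral_lossDiff_sq _).sqrt.const_mul _).add (measurable_integral_lossDiff _)

end Risk

/-! ### Markov's inequality and conditioning on an independent variable. -/

/-- The strict inequality in the event keeps Markov's bound valid for `v = 0`, which occurs when the
initial estimator equals the quantile. -/
lemma measureReal_mul_lt_le {Ω : Type*} [MeasurableSpace Ω] {μ : Measure Ω}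
    [IsProbabilityMeasure μ] {Y : Ω → ℝ} (hY : Integrable Y μ) (h0 : ∀ ω, 0 ≤ Y ω) {v A : ℝ}
    (hA : 0 < A) (hv : ∫ ω, Y ω ∂μ ≤ v) : μ.real {ω | A * v < Y ω} ≤ 1 / A := by
  have hv0 : 0 ≤ v := (integral_nonneg h0).trans hv
  rcases hv0.eq_or_lt with rfl | hpos
  · have hz := (integral_eq_zero_iff_of_nonneg h0 hY).mp (le_antisymm hv (integral_nonneg h0))
    have : μ.real {ω | A * 0 < Y ω} = 0 := by
      rw [measureReal_def, ENNReal.toReal_eq_zero_iff]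
      left
      refine measure_mono_null (fun ω hω => ?_) (ae_iff.mp hz)
      simp only [mul_zero, Set.mem_ofPred_eq] at hω
      exact hω.ne'
    rw [this]
    positivity
  · have h := mul_meas_ge_le_integral_of_nonneg (ae_of_all μ h0) hY (A * v)
    have hsub : μ.real {ω | A * v < Y ω} ≤ μ.real {ω | A * v ≤ Y ω} :=
      measureReal_mono fun ω (hω : A * v < Y ω) => hω.le
    rw [le_div_iff₀ hA]
    nlinarith [mul_le_mul_of_nonneg_left hsub (mul_pos hA hpos).le]

/-- Fubini on the product law: a bound uniform over fixed `u` survives inserting the independent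
`U`. -/
lemma measure_mem_le_of_indepFun {Ω E F : Type*} [MeasurableSpace Ω] [MeasurableSpace E]
    [MeasurableSpace F] {μ : Measure Ω} [IsProbabilityMeasure μ] {U : Ω → E} {V : Ω → F}
    (hU : Measurable U) (hV : Measurable V) (h : IndepFun U V μ) {B : Set (E × F)}
    (hB : MeasurableSet B) {p : ℝ} (hp : ∀ u, μ.real {ω | (u, V ω) ∈ B} ≤ p) :
    μ.real {ω | (U ω, V ω) ∈ B} ≤ p := by
  have hp0 : 0 ≤ p := by
    obtain ⟨ω⟩ := nonempty_of_isProbabilityMeasure μ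
    exact measureReal_nonneg.trans (hp (U ω))
  have hmap := (indepFun_iff_map_prod_eq_prod_map_map hU.aemeasurable hV.aemeasurable).mp h
  have := Measure.isProbabilityMeasure_map (μ := μ) hU.aemeasurable
  have := Measure.isProbabilityMeasure_map (μ := μ) hV.aemeasurable
  have h1 : μ {ω | (U ω, V ω) ∈ B} = ((μ.map U).prod (μ.map V)) B := by
    rw [← hmap, Measure.map_apply (hU.prodMk hV) hB]; rfl
  rw [measureReal_def, h1, Measure.prod_apply hB]
  refine ENNReal.toReal_le_of_le_ofReal hp0 ?_
  calc _ ≤ ∫⁻ _, ENNReal.ofReal p ∂(μ.map U) := lintegral_mono fun u => by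
        rw [Measure.map_apply hV (measurable_prodMk_left hB)]
        exact (ENNReal.le_ofReal_iff_toReal_le (measure_ne_top _ _) hp0).mpr (hp u)
    _ = _ := by simp

/-! ### Moments and deviations of empirical means. -/

namespace IsIIDSample

variable {Ω : Type*} [MeasurableSpace Ω] {μ : Measure Ω} {N : ℕ}
  {X : Fin N → Ω → ℝ} {P : Measure ℝ} {I : Finset (Fin N)} {f : ℝ → ℝ}

lemma measurable_subsample (hX : IsIIDSample X P μ) (I : Finset (Fin N)) :
    Measurable (subsample X I) :=
  measurable_pi_lambda _ fun i => hX.measurable i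

lemma indepFun_subsample (hX : IsIIDSample X P μ) {I₁ I₂ : Finset (Fin N)}
    (h : Disjoint I₁ I₂) : IndepFun (subsample X I₁) (subsample X I₂) μ :=
  hX.indep.indepFun_finset I₁ I₂ h hX.measurable

lemma integral_comp (hX : IsIIDSample X P μ) (hf : Measurable f) (i : Fin N) :
    ∫ ω, f (X i ω) ∂μ = ∫ x, f x ∂P := by
  rw [← hX.law i, integral_map (hX.measurable i).aemeasurable hf.aestronglyMeasurable]

lemma integrable_comp (hX : IsIIDSample X P μ) (hf : Measurable f) (hi : Integrable f P)
    (i : Fin N) : Integrable (fun ω => f (X i ω)) μ := by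
  rw [← hX.law i] at hi
  exact (integrable_map_measure hf.aestronglyMeasurable (hX.measurable i).aemeasurable).mp hi

lemma integrable_empMean (hX : IsIIDSample X P μ) (hf : Measurable f) (hi : Integrable f P) :
    Integrable (fun ω => empMean (subsample X I ω) f) μ :=
  by
  unfold empMean subsample
  exact (integrable_finsetSum _ fun (i : I) _ => hX.integrable_comp hf hi i).div_const _

lemma integral_empMean (hX : IsIIDSample X P μ) (hI : 0 < I.card) (hf : Measurable f)
    (hi : Integrable f P) : ∫ ω, empMean (subsample X I ω) f ∂μ = ∫ x, f x ∂P := by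
  unfold empMean subsample
  rw [integral_div, integral_finsetSum _ fun (i : I) _ => hX.integrable_comp hf hi i]
  simp_rw [hX.integral_comp hf]
  have : (I.card : ℝ) ≠ 0 := by positivity
  simp [field]

lemma memLp_comp (hX : IsIIDSample X P μ) (hf : Measurable f)
    (hi : Integrable (fun x => f x ^ 2) P) (i : Fin N) : MemLp (fun ω => f (X i ω)) 2 μ :=
  (memLp_two_iff_integrable_sq (hf.comp (hX.measurable i)).aestronglyMeasurable).mpr
    (hX.integrable_comp (hf.pow_const 2) hi i)

lemma memLp_empMean (hX : IsIIDSample X P μ) (hf : Measurable f)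
    (hi : Integrable (fun x => f x ^ 2) P) :
    MemLp (fun ω => empMean (subsample X I ω) f) 2 μ := by
  unfold empMean subsample
  simp_rw [div_eq_inv_mul]
  exact (memLp_finsetSum _ fun (i : I) _ => hX.memLp_comp hf hi i).const_mul _

variable [IsProbabilityMeasure μ]

lemma variance_empMean_le (hX : IsIIDSample X P μ) (hI : 0 < I.card) (hf : Measurable f)
    (hi : Integrable (fun x => f x ^ 2) P) :
    Var[fun ω => empMean (subsample X I ω) f; μ] ≤ (∫ x, f x ^ 2 ∂P) / I.card := by
  have hind : Set.Pairwise (↑(Finset.univ : Finset I)) fun i j : I =>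
      IndepFun (fun ω => f (X i ω)) (fun ω => f (X j ω)) μ := fun i _ j _ hij =>
    (hX.indep.indepFun (fun h => hij (Subtype.ext h))).comp hf hf
  have hsum := IndepFun.variance_sum (X := fun (i : I) ω => f (X i ω))
    (s := Finset.univ) (fun i _ => hX.memLp_comp hf hi i) hind
  have hle : ∀ i : I, Var[fun ω => f (X i ω); μ] ≤ ∫ x, f x ^ 2 ∂P := fun i => by
    refine (variance_le_expectation_sq
      (hf.comp (hX.measurable i)).aestronglyMeasurable).trans_eq ?_
    exact hX.integral_comp (hf.pow_const 2) i
  have heq : (fun ω => empMean (subsample X I ω) f)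
      = fun ω => (I.card : ℝ)⁻¹ * (∑ i : I, fun ω => f (X i ω)) ω := by
    ext ω
    simp [empMean, subsample, div_eq_inv_mul]
  have hc : (0 : ℝ) < I.card := by exact_mod_cast hI
  rw [heq, variance_const_mul, hsum]
  calc _ ≤ ((I.card : ℝ)⁻¹) ^ 2 * ∑ _i : I, ∫ x, f x ^ 2 ∂P := by
        gcongr with i; exact hle i
    _ = _ := by simp; field_simp

lemma measureReal_empMean_deviation_le (hX : IsIIDSample X P μ) (hI : 0 < I.card)
    (hf : Measurable f) (hf1 : Integrable f P) (hf2 : Integrable (fun x => f x ^ 2) P) {A v : ℝ}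
    (hA : 0 < A) (hv : ∫ x, f x ^ 2 ∂P ≤ v) :
    μ.real {ω | A * (v / I.card) < (empMean (subsample X I ω) f - ∫ x, f x ∂P) ^ 2} ≤ 1 / A := by
  have hm := hX.memLp_empMean (I := I) hf hf2
  have hvar := hX.variance_empMean_le hI hf hf2
  rw [variance_eq_integral hm.aestronglyMeasurable.aemeasurable,
    hX.integral_empMean hI hf hf1] at hvar
  refine measureReal_mul_lt_le ?_ (fun _ => sq_nonneg _) hA
    (hvar.trans (by gcongr))
  exact (hm.sub (memLp_const _)).integrable_sq

lemma measureReal_empMean_sq_le (hX : IsIIDSample X P μ) (hI : 0 < I.card)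
    (hf : Measurable f) (hf2 : Integrable (fun x => f x ^ 2) P) {A : ℝ} (hA : 0 < A) :
    μ.real {ω | A * (∫ x, f x ^ 2 ∂P) < empMean (subsample X I ω) fun x => f x ^ 2} ≤ 1 / A :=
  measureReal_mul_lt_le (hX.integrable_empMean (hf.pow_const 2) hf2)
    (fun _ => div_nonneg (Finset.sum_nonneg fun _ _ => sq_nonneg _) (by positivity)) hA
    (hX.integral_empMean hI (hf.pow_const 2) hf2).le

end IsIIDSample

/-! ### Deterministic consequences of membership and convexity. -/

section Deterministic

variable {ι : Type*} [Fintype ι] {x : ι → ℝ}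

lemma empMean_mono {f g : ℝ → ℝ} (h : ∀ y, f y ≤ g y) : empMean x f ≤ empMean x g := by
  unfold empMean
  gcongr with i
  exact h _

lemma empMean_const_mul (c : ℝ) (f : ℝ → ℝ) :
    empMean x (fun y => c * f y) = c * empMean x f := by
  unfold empMean
  rw [← Finset.mul_sum, mul_div_assoc]

lemma empMean_add (f g : ℝ → ℝ) :
    empMean x (fun y => f y + g y) = empMean x f + empMean x g := by
  unfold empMean
  rw [Finset.sum_add_distrib, add_div]

lemma empMean_sub (f g : ℝ → ℝ) :
    empMean x (fun y => f y - g y) = empMean x f - empMean x g := by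
  unfold empMean
  rw [Finset.sum_sub_distrib, sub_div]

lemma empMean_const (h : 0 < Fintype.card ι) (c : ℝ) : empMean x (fun _ => c) = c := by
  unfold empMean
  have : (Fintype.card ι : ℝ) ≠ 0 := by positivity
  simp [field]

/-- Dropping the centring only increases the sum; the factor 2 is `n ≤ 2 (n - 1)`. -/
lemma sampleSD_le (h : 2 ≤ Fintype.card ι) (f : ℝ → ℝ) :
    sampleSD x f ≤ Real.sqrt (2 * empMean x fun y => f y ^ 2) := by
  unfold sampleSD
  apply Real.sqrt_le_sqrt
  have hn : (2 : ℝ) ≤ Fintype.card ι := by exact_mod_cast h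
  have hsum : ∑ i, f (x i) = Fintype.card ι * empMean x f := by
    unfold empMean; field_simp
  have hexp : ∑ i, (f (x i) - empMean x f) ^ 2
      = ∑ i, f (x i) ^ 2 - Fintype.card ι * empMean x f ^ 2 := by
    simp_rw [sub_sq]
    rw [Finset.sum_add_distrib, Finset.sum_sub_distrib, ← Finset.sum_mul, ← Finset.mul_sum, hsum]
    simp
    ring
  have hS : 0 ≤ ∑ i, f (x i) ^ 2 := Finset.sum_nonneg fun _ _ => sq_nonneg _
  have h1 : ∑ i, (f (x i) - empMean x f) ^ 2 ≤ ∑ i, f (x i) ^ 2 := by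
    rw [hexp]
    have : 0 ≤ (Fintype.card ι : ℝ) * empMean x f ^ 2 := by positivity
    linarith
  unfold empMean
  rw [div_le_iff₀ (by linarith)]
  calc _ ≤ ∑ i, f (x i) ^ 2 := h1
    _ ≤ 2 * ((∑ i, f (x i) ^ 2) / Fintype.card ι) * (Fintype.card ι - 1) := by
        rw [mul_assoc, div_mul_eq_mul_div, ← mul_div_assoc, le_div_iff₀ (by linarith)]
        nlinarith

/-- Recentres the defining inequality at `θ₀`. The Lipschitz bound makes the standard deviation at
most linear in `|θ - θ₀|`, and `|z_α|` covers a negative critical value. -/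
lemma empMean_lossDiff_le_of_mem_cltSet {γ α θ₁ θ : ℝ} (h0 : 0 < γ) (h1 : γ < 1)
    (hn : 2 ≤ Fintype.card ι) (θ₀ : ℝ) (hθ : θ ∈ cltSet γ α θ₁ x) :
    empMean x (lossDiff γ θ θ₀) ≤ empMean x (lossDiff γ θ₁ θ₀)
      + (Fintype.card ι : ℝ) ^ (-(1 / 2) : ℝ) * |normalCritical α|
        * (2 * |θ - θ₀| + 2 * Real.sqrt (empMean x fun y => lossDiff γ θ₁ θ₀ y ^ 2)) := by
  have hmean : empMean x (lossDiff γ θ θ₁)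
      = empMean x (lossDiff γ θ θ₀) - empMean x (lossDiff γ θ₁ θ₀) := by
    rw [← empMean_sub]
    congr 1; ext y; exact lossDiff_sub ..
  set V := empMean x fun y => lossDiff γ θ₁ θ₀ y ^ 2 with hV
  have hV0 : 0 ≤ V := div_nonneg (Finset.sum_nonneg fun _ _ => sq_nonneg _) (by positivity)
  have hsq : (empMean x fun y => lossDiff γ θ θ₁ y ^ 2) ≤ 2 * (θ - θ₀) ^ 2 + 2 * V := by
    calc _ ≤ empMean x fun y => 2 * (θ - θ₀) ^ 2 + 2 * lossDiff γ θ₁ θ₀ y ^ 2 := by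
          refine empMean_mono fun y => ?_
          rw [lossDiff_sub γ θ θ₁ θ₀]
          have := lossDiff_sq_le h0 h1 θ θ₀ y
          nlinarith [sq_nonneg (lossDiff γ θ θ₀ y + lossDiff γ θ₁ θ₀ y)]
      _ = _ := by rw [empMean_add, empMean_const (by omega), empMean_const_mul]
  have hsd : sampleSD x (lossDiff γ θ θ₁) ≤ 2 * |θ - θ₀| + 2 * Real.sqrt V := by
    refine (sampleSD_le hn _).trans (Real.sqrt_le_iff.mpr ⟨by positivity, ?_⟩)
    have := Real.sq_sqrt hV0
    have h2 := sq_abs (θ - θ₀)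
    have h3 : 0 ≤ |θ - θ₀| * Real.sqrt V := by positivity
    nlinarith
  have hm : empMean x (lossDiff γ θ θ₁) ≤
    (Fintype.card ι : ℝ) ^ (-(1 / 2) : ℝ) * normalCritical α * sampleSD x (lossDiff γ θ θ₁) := hθ
  have hle : (Fintype.card ι : ℝ) ^ (-(1 / 2) : ℝ) * normalCritical α
      * sampleSD x (lossDiff γ θ θ₁) ≤ (Fintype.card ι : ℝ) ^ (-(1 / 2) : ℝ) * |normalCritical α|
        * (2 * |θ - θ₀| + 2 * Real.sqrt V) := by
    have h0 : 0 ≤ sampleSD x (lossDiff γ θ θ₁) := Real.sqrt_nonneg _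
    calc _ ≤ (Fintype.card ι : ℝ) ^ (-(1 / 2) : ℝ) * |normalCritical α|
          * sampleSD x (lossDiff γ θ θ₁) := by
          gcongr; exact le_abs_self _
      _ ≤ _ := by gcongr
  linarith

/-- The point at distance `r` from `θ₀` towards `θ` is one of `θ₀ ± r`, so convexity lets these two
points control every farther `θ`. -/
lemma mul_le_empMean_lossDiff {γ θ₀ θ r B : ℝ} (h0 : 0 < γ) (h1 : γ < 1) (hr : 0 < r)
    (hθ : r ≤ |θ - θ₀|) (hright : B ≤ empMean x (lossDiff γ (θ₀ + r) θ₀))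
    (hleft : B ≤ empMean x (lossDiff γ (θ₀ - r) θ₀)) :
    B * |θ - θ₀| ≤ r * empMean x (lossDiff γ θ θ₀) := by
  have hd : 0 < |θ - θ₀| := hr.trans_le hθ
  have key : ∀ θ', θ' = θ₀ + r / |θ - θ₀| * (θ - θ₀) → B ≤ empMean x (lossDiff γ θ' θ₀) →
      B * |θ - θ₀| ≤ r * empMean x (lossDiff γ θ θ₀) := by
    rintro _ rfl hB
    have := hB.trans (empMean_mono fun y => lossDiff_segment_le h0 h1 θ θ₀ y
      (t := r / |θ - θ₀|) (by positivity) ((div_le_one hd).mpr hθ))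
    rwa [empMean_const_mul, div_mul_eq_mul_div, le_div_iff₀ hd] at this
  rcases lt_or_ge (θ - θ₀) 0 with hneg | hpos
  · refine key _ ?_ hleft
    rw [abs_of_neg hneg]
    have := hneg.ne
    field_simp; ring
  · refine key _ ?_ hright
    rw [abs_of_nonneg hpos] at hd ⊢
    have := hd.ne'
    field_simp

end Deterministic

/-! ### Deviations at a random parameter independent of the sample. -/

namespace IsIIDSample

variable {Ω : Type*} [MeasurableSpace Ω] {μ : Measure Ω} [IsProbabilityMeasure μ] {N : ℕ}
  {X : Fin N → Ω → ℝ} {P : Measure ℝ} [IsProbabilityMeasure P] {I : Finset (Fin N)}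
  {γ : ℝ} {U : Ω → ℝ}

lemma measureReal_lossDiff_deviation_le (hX : IsIIDSample X P μ) (hI : 0 < I.card)
    (h0 : 0 < γ) (h1 : γ < 1) (hU : Measurable U) (hind : IndepFun U (subsample X I) μ)
    (θ₀ : ℝ) {A : ℝ} (hA : 0 < A) :
    μ.real {ω | A * ((∫ x, lossDiff γ (U ω) θ₀ x ^ 2 ∂P) / I.card)
      < (empMean (subsample X I ω) (lossDiff γ (U ω) θ₀)
          - ∫ x, lossDiff γ (U ω) θ₀ x ∂P) ^ 2} ≤ 1 / A := by
  refine measure_mem_le_of_indepFun hU (hX.measurable_subsample I) hind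
    (B := {p | A * ((∫ x, lossDiff γ p.1 θ₀ x ^ 2 ∂P) / I.card)
      < (empMean p.2 (lossDiff γ p.1 θ₀) - ∫ x, lossDiff γ p.1 θ₀ x ∂P) ^ 2}) ?_ fun u => ?_
  · have := (measurable_integral_lossDiff (P := P) (γ := γ) θ₀).comp
      (measurable_fst : Measurable (Prod.fst : ℝ × (I → ℝ) → ℝ))
    have h2 := (measurable_integral_lossDiff_sq (P := P) (γ := γ) θ₀).comp
      (measurable_fst : Measurable (Prod.fst : ℝ × (I → ℝ) → ℝ))
    refine measurableSet_lt ((h2.div_const _).const_mul _) (Measurable.pow_const (.sub ?_ this) 2)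
    unfold empMean
    fun_prop
  · exact hX.measureReal_empMean_deviation_le hI (by fun_prop) (integrable_lossDiff h0 h1 _ _)
      (integrable_lossDiff_sq h0 h1 _ _) hA le_rfl

lemma measureReal_lossDiff_sq_le (hX : IsIIDSample X P μ) (hI : 0 < I.card)
    (h0 : 0 < γ) (h1 : γ < 1) (hU : Measurable U) (hind : IndepFun U (subsample X I) μ)
    (θ₀ : ℝ) {A : ℝ} (hA : 0 < A) :
    μ.real {ω | A * (∫ x, lossDiff γ (U ω) θ₀ x ^ 2 ∂P)
      < empMean (subsample X I ω) fun x => lossDiff γ (U ω) θ₀ x ^ 2} ≤ 1 / A := by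
  refine measure_mem_le_of_indepFun hU (hX.measurable_subsample I) hind
    (B := {p | A * (∫ x, lossDiff γ p.1 θ₀ x ^ 2 ∂P)
      < empMean p.2 fun x => lossDiff γ p.1 θ₀ x ^ 2}) ?_ fun u => ?_
  · have h2 := (measurable_integral_lossDiff_sq (P := P) (γ := γ) θ₀).comp
      (measurable_fst : Measurable (Prod.fst : ℝ × (I → ℝ) → ℝ))
    refine measurableSet_lt (h2.const_mul _) ?_
    unfold empMean
    fun_prop
  · exact hX.measureReal_empMean_sq_le hI (by fun_prop) (integrable_lossDiff_sq h0 h1 _ _) hA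

end IsIIDSample

/-! ### Localization of the confidence set. -/

lemma rpow_neg_half_eq (n : ℕ) : (n : ℝ) ^ (-(1 / 2) : ℝ) = (Real.sqrt n)⁻¹ := by
  rw [Real.rpow_neg (by positivity), Real.sqrt_eq_rpow]

lemma abs_sub_le_of_mem_cltSet {ι : Type*} [Fintype ι] {x : ι → ℝ} {P : Measure ℝ}
    [IsProbabilityMeasure P] {γ α β δ M₀ M₁ : ℝ} (h : HolderAtQuantile P γ β δ M₀ M₁)
    (h0 : 0 < γ) (h1 : γ < 1) (hβ : 0 < β) (hM : M₁ < M₀) (hn : 2 ≤ Fintype.card ι)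
    {a r θ₁ : ℝ} (ha : 0 ≤ a) (hr : 0 < r) (hrδ : r ≤ δ)
    (hlarge : 2 * (a + 2 * |normalCritical α|) * (Fintype.card ι : ℝ) ^ (-(1 / 2) : ℝ)
      ≤ (M₀ - M₁) / 2 ^ (1 + β) * r ^ β)
    (hdev : ∀ θ ∈ ({quantile P γ + r, quantile P γ - r, θ₁} : Set ℝ),
      (empMean x (lossDiff γ θ (quantile P γ)) - ∫ y, lossDiff γ θ (quantile P γ) y ∂P) ^ 2
        ≤ a ^ 2 * ((∫ y, lossDiff γ θ (quantile P γ) y ^ 2 ∂P) / Fintype.card ι))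
    (hsq : (empMean x fun y => lossDiff γ θ₁ (quantile P γ) y ^ 2)
      ≤ a ^ 2 * ∫ y, lossDiff γ θ₁ (quantile P γ) y ^ 2 ∂P)
    {θ : ℝ} (hθ : θ ∈ cltSet γ α θ₁ x) :
    |θ - quantile P γ| ≤ max r (2 * (1 + a + 2 * |normalCritical α| * a)
      * initialError P γ (Fintype.card ι) θ₁ / ((M₀ - M₁) / 2 ^ (1 + β) * r ^ β)) := by
  rcases le_or_gt (|θ - quantile P γ|) r with hle | hgt
  · exact hle.trans (le_max_left _ _)
  refine le_max_of_le_right ?_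
  have hδ := hr.trans_le hrδ
  set θ₀ := quantile P γ with hθ₀
  set n := Fintype.card ι with hn'
  set w : ℝ := (n : ℝ) ^ (-(1 / 2) : ℝ) with hw
  set z := |normalCritical α| with hz
  set c := (M₀ - M₁) / 2 ^ (1 + β) with hc
  have hz0 : 0 ≤ z := abs_nonneg _
  have hw0 : 0 ≤ w := by positivity
  have hnpos : (0 : ℝ) < n := by exact_mod_cast (by omega : 0 < n)
  have hc0 : 0 < c := div_pos (by linarith) (by positivity)
  have hcr : 0 < c * r ^ β := mul_pos hc0 (by positivity)
  -- The constant `c` carries `2^{1+β}` because the risk bound comes from the midpoint `r / 2`.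
  have hcurv : (M₀ - M₁) * (r / 2) ^ β * (r / 2) = c * r ^ β * r := by
    rw [hc, Real.div_rpow hr.le zero_le_two, Real.rpow_add zero_lt_two, Real.rpow_one]
    field_simp
  have hdev' : ∀ θ ∈ ({θ₀ + r, θ₀ - r, θ₁} : Set ℝ),
      |empMean x (lossDiff γ θ θ₀) - ∫ y, lossDiff γ θ θ₀ y ∂P|
        ≤ a * (w * Real.sqrt (∫ y, lossDiff γ θ θ₀ y ^ 2 ∂P)) := by
    intro θ hθ
    have hV : 0 ≤ ∫ y, lossDiff γ θ θ₀ y ^ 2 ∂P := integral_nonneg fun _ => sq_nonneg _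
    have h3 : (a * (w * Real.sqrt (∫ y, lossDiff γ θ θ₀ y ^ 2 ∂P))) ^ 2
        = a ^ 2 * ((∫ y, lossDiff γ θ θ₀ y ^ 2 ∂P) / n) := by
      rw [hw, rpow_neg_half_eq, mul_pow, mul_pow, inv_pow, Real.sq_sqrt hnpos.le, Real.sq_sqrt hV]
      ring
    exact abs_le_of_sq_le_sq ((hdev θ hθ).trans_eq h3.symm) (by positivity)
  have hside : ∀ θ ∈ ({θ₀ + r, θ₀ - r, θ₁} : Set ℝ), |θ - θ₀| = r →
      c * r ^ β * r ≤ ∫ y, lossDiff γ θ θ₀ y ∂P →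
      (c * r ^ β - a * w) * r ≤ empMean x (lossDiff γ θ θ₀) := by
    intro θ hθ hr' hlow
    have hV : Real.sqrt (∫ y, lossDiff γ θ θ₀ y ^ 2 ∂P) ≤ r := by
      refine Real.sqrt_le_iff.mpr ⟨hr.le, ?_⟩
      rw [← hr', sq_abs]
      exact integral_lossDiff_sq_le h0 h1 θ θ₀
    have h3 := (abs_le.mp (hdev' θ hθ)).1
    have h4 : a * (w * Real.sqrt (∫ y, lossDiff γ θ θ₀ y ^ 2 ∂P)) ≤ a * (w * r) := by gcongr
    linarith
  have hright := hside (θ₀ + r) (by simp) (by simp [abs_of_pos hr])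
    (hcurv.symm.trans_le (h.le_integral_lossDiff_right h0 h1 hβ hr hrδ))
  have hleft := hside (θ₀ - r) (by simp) (by simp [abs_of_pos hr])
    (hcurv.symm.trans_le (h.le_integral_lossDiff_left h0 h1 hβ hr hrδ))
  have hlow := mul_le_empMean_lossDiff h0 h1 hr hgt.le hright hleft
  have hup := empMean_lossDiff_le_of_mem_cltSet h0 h1 hn θ₀ hθ
  set V := ∫ y, lossDiff γ θ₁ θ₀ y ^ 2 ∂P with hV
  have hV0 : 0 ≤ V := integral_nonneg fun _ => sq_nonneg _
  have hsq' : Real.sqrt (empMean x fun y => lossDiff γ θ₁ θ₀ y ^ 2) ≤ a * Real.sqrt V := by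
    refine Real.sqrt_le_iff.mpr ⟨by positivity, ?_⟩
    rwa [mul_pow, Real.sq_sqrt hV0]
  have hmean := (abs_le.mp (hdev' θ₁ (by simp))).2
  have hG := h.integral_lossDiff_nonneg h0 h1 hβ hδ θ₁
  have hs : initialError P γ n θ₁ = w * Real.sqrt V + ∫ y, lossDiff γ θ₁ θ₀ y ∂P := rfl
  set G := ∫ y, lossDiff γ θ₁ θ₀ y ∂P with hGdef
  set D := |θ - θ₀| with hD
  have hDpos : 0 < D := hr.trans hgt
  -- Both sides are linear in `D`; `hlarge` leaves at least half the slope `c r^β` after absorption.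
  have hkey : (c * r ^ β - a * w) * D ≤ G + a * (w * Real.sqrt V)
      + w * z * (2 * D + 2 * (a * Real.sqrt V)) := by
    have h5 : (c * r ^ β - a * w) * D ≤ empMean x (lossDiff γ θ θ₀) := by
      refine le_of_mul_le_mul_left ?_ hr
      linarith
    have h6 : w * z * (2 * D + 2 * Real.sqrt (empMean x fun y => lossDiff γ θ₁ θ₀ y ^ 2))
      ≤ w * z * (2 * D + 2 * (a * Real.sqrt V)) := by gcongr
    linarith
  rw [le_div_iff₀ hcr, hs]
  have h7 := mul_le_mul_of_nonneg_right hlarge hDpos.le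
  have h8 : 0 ≤ w * Real.sqrt V := by positivity
  have h9 : 0 ≤ (a + 2 * z * a) * G := by positivity
  linarith

lemma rpow_neg_half_mul_rpow {n : ℕ} {β : ℝ} (hβ : 0 < β) :
    ((n : ℝ) ^ (-(1 / (2 * β)))) ^ β = (n : ℝ) ^ (-(1 / 2) : ℝ) := by
  rw [← Real.rpow_mul (by positivity)]
  congr 1
  field_simp

lemma rpow_neg_half_le {n : ℕ} {β δ C : ℝ} (hδ : 0 < δ) (hC : 0 < C)
    (hn : C * δ ^ (-(2 * β)) ≤ n) : (n : ℝ) ^ (-(1 / 2) : ℝ) ≤ C ^ (-(1 / 2) : ℝ) * δ ^ β := by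
  calc _ ≤ (C * δ ^ (-(2 * β))) ^ (-(1 / 2) : ℝ) :=
        Real.rpow_le_rpow_of_nonpos (by positivity) hn (by norm_num)
    _ = _ := by
        rw [Real.mul_rpow hC.le (by positivity), ← Real.rpow_mul hδ.le]
        congr 2; ring

lemma rpow_neg_inv_two_mul_le {n : ℕ} {β δ C : ℝ} (hβ : 0 < β) (hδ : 0 < δ) (hC : 0 < C)
    (hn : C * δ ^ (-(2 * β)) ≤ n) :
    (n : ℝ) ^ (-(1 / (2 * β))) ≤ C ^ (-(1 / (2 * β))) * δ := by
  calc _ ≤ (C * δ ^ (-(2 * β))) ^ (-(1 / (2 * β))) :=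
        Real.rpow_le_rpow_of_nonpos (by positivity) hn (by simp; positivity)
    _ = _ := by
        rw [Real.mul_rpow hC.le (by positivity), ← Real.rpow_mul hδ.le]
        rw [show -(2 * β) * -(1 / (2 * β)) = 1 by field_simp, Real.rpow_one]

/-- Only the Lipschitz bound enters, so this also serves outside the `δ`-neighbourhood. -/
lemma initialError_le {P : Measure ℝ} [IsProbabilityMeasure P] {γ : ℝ} (h0 : 0 < γ)
    (h1 : γ < 1) {n : ℕ} (hn : 1 ≤ n) (θ : ℝ) :
    initialError P γ n θ ≤ 2 * |θ - quantile P γ| := by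
  have hw : (n : ℝ) ^ (-(1 / 2) : ℝ) ≤ 1 :=
    Real.rpow_le_one_of_one_le_of_nonpos (by exact_mod_cast hn) (by norm_num)
  have hV : Real.sqrt (∫ x, lossDiff γ θ (quantile P γ) x ^ 2 ∂P) ≤ |θ - quantile P γ| :=
    Real.sqrt_le_iff.mpr ⟨abs_nonneg _, by
      rw [sq_abs]; exact integral_lossDiff_sq_le h0 h1 _ _⟩
  have hG := integral_lossDiff_le (P := P) h0 h1 θ (quantile P γ)
  have := mul_le_mul hw hV (Real.sqrt_nonneg _) zero_le_one
  unfold initialError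
  linarith

lemma measureReal_union₄_le {Ω : Type*} [MeasurableSpace Ω] {μ : Measure Ω}
    [IsProbabilityMeasure μ] {S B₁ B₂ B₃ B₄ : Set Ω} {p : ℝ} (hS : S ⊆ B₁ ∪ B₂ ∪ B₃ ∪ B₄)
    (h₁ : μ.real B₁ ≤ p) (h₂ : μ.real B₂ ≤ p) (h₃ : μ.real B₃ ≤ p) (h₄ : μ.real B₄ ≤ p) :
    μ.real S ≤ 4 * p := by
  have a := measureReal_mono (μ := μ) hS
  have b := measureReal_union_le (μ := μ) (B₁ ∪ B₂ ∪ B₃) B₄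
  have c := measureReal_union_le (μ := μ) (B₁ ∪ B₂) B₃
  have d := measureReal_union_le (μ := μ) B₁ B₂
  linarith

/-- The localization radius `K (n^{-1/(2β)} + s^{1/(1+β)})`, where `s` is the accuracy of the
value `θ` of the initial estimator. -/
def localRadius (P : Measure ℝ) (γ β K : ℝ) (n : ℕ) (θ : ℝ) : ℝ :=
  K * ((n : ℝ) ^ (-(1 / (2 * β))) + initialError P γ n θ ^ (1 / (1 + β)))

lemma measurable_localRadius {P : Measure ℝ} [IsProbabilityMeasure P] (γ β K : ℝ) (n : ℕ) :
    Measurable (localRadius P γ β K n) :=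
  (((measurable_initialError n).pow_const _).const_add _).const_mul _

theorem exists_localization (ε α β M₀ M₁ : ℝ) (hε : 0 < ε) (hβ : 0 < β) (hM : M₁ < M₀) :
    ∃ K > 0, ∃ L > 0, ∃ C₁ > 0, ∀ (γ δ : ℝ) (P : Measure ℝ) [IsProbabilityMeasure P],
      0 < γ → γ < 1 → 0 < δ → HolderAtQuantile P γ β δ M₀ M₁ →
      ∀ (Ω : Type*) [MeasurableSpace Ω] (μ : Measure Ω) [IsProbabilityMeasure μ]
        (N : ℕ) (X : Fin N → Ω → ℝ) (I : Finset (Fin N)) (U : Ω → ℝ),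
        IsIIDSample X P μ → Measurable U → IndepFun U (subsample X I) μ →
        C₁ * δ ^ (-(2 * β)) ≤ (I.card : ℝ) →
        μ.real {ω | ¬ ∀ θ ∈ cltSet γ α (U ω) (subsample X I ω),
          (localRadius P γ β K I.card (U ω) ≤ δ →
            |θ - quantile P γ| ≤ localRadius P γ β K I.card (U ω)) ∧
          |θ - quantile P γ| ≤ max δ (L * δ ^ (-β) * |U ω - quantile P γ|)} ≤ ε := by
  set z := |normalCritical α| with hz
  have hz0 : 0 ≤ z := abs_nonneg _
  -- Four exceptional events, each of probability at most `1 / A = ε / 4`.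
  set A := 4 / ε with hA
  have hA0 : 0 < A := by positivity
  set a := Real.sqrt A with ha
  have ha0 : 0 ≤ a := Real.sqrt_nonneg _
  have ha2 : a ^ 2 = A := Real.sq_sqrt hA0.le
  set c := (M₀ - M₁) / 2 ^ (1 + β) with hc
  have hM0 : 0 < M₀ - M₁ := by linarith
  have hc0 : 0 < c := by positivity
  set H := 1 + a + 2 * z * a with hH
  have hH0 : 0 < H := by positivity
  set b := 2 * (a + 2 * z) with hb
  have hb0 : 0 ≤ b := by positivity
  -- The first entry makes `c q^β` dominate the noise `b w`; the second gives `2 H s / (c q^β) ≤ q`,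
  -- for `q` the local radius.
  set K := max ((b / c) ^ (1 / β)) ((2 * H / c) ^ (1 / (1 + β))) with hK
  have hβ1 : 0 < 1 + β := by linarith
  have hK0 : 0 < K := lt_max_of_lt_right (by positivity)
  have hKb : b ≤ c * K ^ β := by
    have : ((b / c) ^ (1 / β)) ^ β ≤ K ^ β :=
      Real.rpow_le_rpow (by positivity) (le_max_left _ _) hβ.le
    rw [← Real.rpow_mul (by positivity), one_div_mul_cancel hβ.ne', Real.rpow_one,
      div_le_iff₀ hc0] at this
    linarith
  have hKH : 2 * H ≤ c * K ^ (1 + β) := by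
    have : ((2 * H / c) ^ (1 / (1 + β))) ^ (1 + β) ≤ K ^ (1 + β) :=
      Real.rpow_le_rpow (by positivity) (le_max_right _ _) hβ1.le
    rw [← Real.rpow_mul (by positivity), one_div_mul_cancel hβ1.ne', Real.rpow_one,
      div_le_iff₀ hc0] at this
    linarith
  -- The first entry forces `n ≥ 2`; the second makes the truncated radius `δ` dominate the noise.
  set C₁ := max (2 / (M₀ - M₁) ^ 2) ((b / c) ^ 2) with hC₁
  have hC₁0 : 0 < C₁ := lt_max_of_lt_left (by positivity)
  have hC₁b : b * C₁ ^ (-(1 / 2) : ℝ) ≤ c := by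
    rw [Real.rpow_neg hC₁0.le, ← Real.sqrt_eq_rpow, ← div_eq_mul_inv,
      div_le_iff₀ (Real.sqrt_pos.mpr hC₁0)]
    have : b / c ≤ Real.sqrt C₁ := Real.le_sqrt_of_sq_le (le_max_right _ _)
    rw [div_le_iff₀ hc0] at this
    linarith
  refine ⟨K, hK0, 4 * H / c, by positivity, C₁, hC₁0, ?_⟩
  intro γ δ P _ h0 h1 hδ h Ω _ μ _ N X I U hX hU hind hn
  set θ₀ := quantile P γ with hθ₀
  set n := I.card with hn'
  have hcard : Fintype.card I = n := Fintype.card_coe I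
  have hn2 : 2 ≤ n := by
    have h3 := h.mul_rpow_le_one hδ
    have h4 : (M₀ - M₁) ^ 2 ≤ δ ^ (-(2 * β)) := by
      rw [Real.rpow_neg hδ.le, mul_comm 2 β, Real.rpow_mul hδ.le, Real.rpow_two,
        le_inv_comm₀ (by positivity) (by positivity), ← inv_pow]
      gcongr
      rw [← one_div, le_div_iff₀ hM0]
      linarith
    have h5 : (2 : ℝ) ≤ n := by
      calc (2 : ℝ) = 2 / (M₀ - M₁) ^ 2 * (M₀ - M₁) ^ 2 := by field_simp
        _ ≤ C₁ * δ ^ (-(2 * β)) := by gcongr; exact le_max_left _ _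
        _ ≤ n := hn
    exact_mod_cast h5
  have hnpos : 0 < I.card := by omega
  have hnpos' : (0 : ℝ) < n := by exact_mod_cast hnpos
  set w : ℝ := (n : ℝ) ^ (-(1 / 2) : ℝ) with hw
  have hw0 : 0 ≤ w := by positivity
  have hlargeδ : b * w ≤ c * δ ^ β := by
    calc b * w ≤ b * (C₁ ^ (-(1 / 2) : ℝ) * δ ^ β) := by
          gcongr; exact rpow_neg_half_le hδ hC₁0 hn
      _ = (b * C₁ ^ (-(1 / 2) : ℝ)) * δ ^ β := by ring
      _ ≤ _ := by gcongr
  set q := localRadius P γ β K n with hq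
  have hs0 : ∀ u, 0 ≤ initialError P γ n u := h.initialError_nonneg h0 h1 hβ hδ n
  have hq0 : ∀ u, 0 < q u := fun u => by
    have := hs0 u
    simp only [hq, localRadius]
    positivity
  have hlargeq : ∀ u, b * w ≤ c * q u ^ β := fun u => by
    have h3 : K * (n : ℝ) ^ (-(1 / (2 * β))) ≤ q u := by
      have := hs0 u
      simp only [hq, localRadius]
      gcongr
      linarith [Real.rpow_nonneg this (1 / (1 + β))]
    have h4 := Real.rpow_le_rpow (by positivity) h3 hβ.le
    rw [Real.mul_rpow hK0.le (by positivity), rpow_neg_half_mul_rpow hβ] at h4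
    calc b * w ≤ (c * K ^ β) * w := by gcongr
      _ = c * (K ^ β * w) := by ring
      _ ≤ _ := by gcongr
  have hqs : ∀ u, 2 * H * initialError P γ n u / (c * q u ^ β) ≤ q u := fun u => by
    have hq0' := hq0 u
    have h3 : K * initialError P γ n u ^ (1 / (1 + β)) ≤ q u := by
      simp only [hq, localRadius]
      gcongr
      linarith [Real.rpow_nonneg hnpos'.le (-(1 / (2 * β)))]
    have h4 := Real.rpow_le_rpow (by have := hs0 u; positivity) h3 hβ1.le
    rw [Real.mul_rpow hK0.le (by have := hs0 u; positivity), ← Real.rpow_mul (hs0 u),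
      one_div_mul_cancel hβ1.ne', Real.rpow_one] at h4
    rw [div_le_iff₀ (by positivity)]
    calc _ ≤ (c * K ^ (1 + β)) * initialError P γ n u := by have := hs0 u; gcongr
      _ = c * (K ^ (1 + β) * initialError P γ n u) := by ring
      _ ≤ c * q u ^ (1 + β) := by gcongr
      _ = _ := by rw [Real.rpow_add hq0', Real.rpow_one]; ring
  set r : ℝ → ℝ := fun u => min δ (q u) with hr
  have hrm : Measurable r := measurable_const.min (measurable_localRadius γ β K n)
  have hr0 : ∀ u, 0 < r u := fun u => lt_min hδ (hq0 u)
  have hlarge : ∀ u, b * w ≤ c * r u ^ β := fun u => by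
    rcases min_choice δ (q u) with h3 | h3
    · simp only [hr, h3]; exact hlargeδ
    · simp only [hr, h3]; exact hlargeq u
  -- The points `θ₀ ± r(U)` are functions of `U`, hence still independent of the sample.
  have hstat : ∀ g : ℝ → ℝ, Measurable g → IndepFun (fun ω => g (U ω)) (subsample X I) μ :=
    fun g hg => hind.comp hg measurable_id
  have hB : ∀ g : ℝ → ℝ, Measurable g → _ := fun g hg =>
    hX.measureReal_lossDiff_deviation_le hnpos h0 h1 (hg.comp hU) (hstat g hg) θ₀ hA0
  have hsum := measureReal_union₄_le (μ := μ) (S := {ω | ¬ ∀ θ ∈ cltSet γ α (U ω) (subsample X I ω),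
          (q (U ω) ≤ δ → |θ - θ₀| ≤ q (U ω)) ∧
          |θ - θ₀| ≤ max δ (4 * H / c * δ ^ (-β) * |U ω - θ₀|)}) ?_
    (hB (fun u => θ₀ + r u) (hrm.const_add _)) (hB (fun u => θ₀ - r u) (hrm.const_sub _))
    (hB id measurable_id) (hX.measureReal_lossDiff_sq_le hnpos h0 h1 hU hind θ₀ hA0)
  · refine hsum.trans_eq ?_
    rw [hA]; field_simp
  intro ω
  contrapose
  simp only [Set.mem_union, Set.mem_ofPred_eq, not_or, not_lt, not_not]
  rintro ⟨⟨⟨hb1, hb2⟩, hb3⟩, hb4⟩ θ hθ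
  have hmain := abs_sub_le_of_mem_cltSet h h0 h1 hβ hM (by rw [hcard]; exact hn2) ha0
    (hr0 (U ω)) (min_le_left _ _) (by rw [hcard]; exact hlarge (U ω))
    (by
      rw [hcard, ha2]
      rintro θ (rfl | rfl | rfl)
      exacts [hb1, hb2, hb3])
    (by rw [ha2]; exact hb4) hθ
  rw [hcard] at hmain
  have hsmall : q (U ω) ≤ δ → |θ - θ₀| ≤ q (U ω) := fun hle => by
    have hrq : r (U ω) = q (U ω) := min_eq_right hle
    rw [hrq] at hmain
    exact hmain.trans (max_le le_rfl (hqs _))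
  refine ⟨hsmall, ?_⟩
  rcases le_or_gt (q (U ω)) δ with hle | hgt
  · exact (hsmall hle).trans (hle.trans (le_max_left _ _))
  · have hrq : r (U ω) = δ := min_eq_left hgt.le
    rw [hrq] at hmain
    refine hmain.trans (max_le_max_left _ ?_)
    have h5 := initialError_le (P := P) h0 h1 (n := n) (by omega) (U ω)
    calc _ ≤ 2 * H * (2 * |U ω - θ₀|) / (c * δ ^ β) := by gcongr
      _ = _ := by rw [Real.rpow_neg hδ.le]; field_simp; ring

/-! ### Width under a rate for the initial estimator. -/

lemma ediam_le_of_forall_abs_sub_le {S : Set ℝ} {θ₀ R : ℝ} (h : ∀ θ ∈ S, |θ - θ₀| ≤ R) :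
    Metric.ediam S ≤ ENNReal.ofReal (2 * R) := by
  refine Metric.ediam_le fun x hx y hy => ?_
  rw [edist_dist]
  refine ENNReal.ofReal_le_ofReal ?_
  have := dist_triangle_right x y θ₀
  rw [Real.dist_eq x θ₀, Real.dist_eq y θ₀] at this
  linarith [h x hx, h y hy]

/-- Subadditivity on `Ω = G ∪ B` requires no measurability, in particular none of the diameter
event. -/
lemma one_sub_le_measureReal {Ω : Type*} [MeasurableSpace Ω] {μ : Measure Ω}
    [IsProbabilityMeasure μ] {G B : Set Ω} {p : ℝ} (h : ∀ ω, ω ∉ B → ω ∈ G)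
    (hB : μ.real B ≤ p) : 1 - p ≤ μ.real G := by
  have h1 : (Set.univ : Set Ω) ⊆ G ∪ B := fun ω _ => by
    by_cases hω : ω ∈ B
    exacts [Or.inr hω, Or.inl (h ω hω)]
  have h2 := (measureReal_mono (μ := μ) h1).trans (measureReal_union_le G B)
  rw [probReal_univ] at h2
  linarith

lemma eventually_mul_rpow_neg_le {β : ℝ} (hβ : 0 < β) (D : ℝ) {δ : ℝ} (hδ : 0 < δ) :
    ∀ᶠ n : ℕ in Filter.atTop, D * (n : ℝ) ^ (-(1 / (2 * β))) ≤ δ := by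
  have h := ((tendsto_rpow_neg_atTop (y := 1 / (2 * β)) (by positivity)).comp
    tendsto_natCast_atTop_atTop).const_mul D
  rw [mul_zero] at h
  exact h.eventually_le_const hδ

theorem exists_width_of_rate (ε α β M₀ M₁ D : ℝ) (hε : 0 < ε) (hβ : 0 < β) (hM₁ : 0 < M₁)
    (hM : M₁ < M₀) (hD : 0 ≤ D) :
    ∃ c > 0, ∀ δ > 0, ∃ n₀ : ℕ, ∀ (γ : ℝ) (P : Measure ℝ) [IsProbabilityMeasure P],
      0 < γ → γ < 1 → HolderAtQuantile P γ β δ M₀ M₁ →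
      ∀ (Ω : Type*) [MeasurableSpace Ω] (μ : Measure Ω) [IsProbabilityMeasure μ]
        (N : ℕ) (X : Fin N → Ω → ℝ) (I : Finset (Fin N)) (U : Ω → ℝ),
        IsIIDSample X P μ → Measurable U → IndepFun U (subsample X I) μ →
        μ.real {ω | ¬ |U ω - quantile P γ| ≤ D * (I.card : ℝ) ^ (-(1 / (2 * β)))} ≤ ε / 2 →
        n₀ ≤ I.card →
        1 - ε ≤ μ.real {ω | Metric.ediam (cltSet γ α (U ω) (subsample X I ω)) ≤
          ENNReal.ofReal (c * (I.card : ℝ) ^ (-(1 / (2 * β))))} := by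
  obtain ⟨K, hK, L, hL, C₁, hC₁, hloc⟩ :=
    exists_localization (ε / 2) α β M₀ M₁ (by linarith) hβ hM
  have hβ1 : 0 < 1 + β := by linarith
  have hM' : 0 ≤ M₀ + M₁ := by linarith
  -- With `t = n^{-1/(2β)}` and `n^{-1/2} = t^β`, the two parts of the initial error are at most `D
  -- t^{1+β}` and `(M₀ + M₁)(D t)^{1+β}`.
  set E := D + (M₀ + M₁) * D ^ (1 + β) with hE
  have hE0 : 0 ≤ E := by positivity
  set R := K * (1 + E ^ (1 / (1 + β))) with hR
  have hR0 : 0 < R := by positivity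
  refine ⟨2 * R, by positivity, fun δ hδ => ?_⟩
  obtain ⟨n₀, hn₀⟩ := Filter.eventually_atTop.mp
    (((eventually_mul_rpow_neg_le hβ D hδ).and (eventually_mul_rpow_neg_le hβ R hδ)).and
      (tendsto_natCast_atTop_atTop.eventually_ge_atTop (C₁ * δ ^ (-(2 * β)))))
  refine ⟨n₀, ?_⟩
  intro γ P _ h0 h1 h Ω _ μ _ N X I U hX hU hind hrate hn
  obtain ⟨⟨hDδ, hRδ⟩, hC⟩ := hn₀ _ hn
  have hbad := hloc γ δ P h0 h1 hδ h Ω μ N X I U hX hU hind hC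
  refine one_sub_le_measureReal (fun ω hω => ?_)
    ((measureReal_union_le _ _).trans ((add_le_add hbad hrate).trans_eq (add_halves ε)))
  simp only [Set.mem_union, Set.mem_ofPred_eq, not_or, not_not] at hω
  obtain ⟨hω, hd⟩ := hω
  set n := I.card with hn'
  set t := (n : ℝ) ^ (-(1 / (2 * β))) with ht
  have ht0 : 0 ≤ t := by positivity
  set θ₀ := quantile P γ with hθ₀
  have hn0 : (0 : ℝ) < n := lt_of_lt_of_le (by positivity) hC
  have htpos : 0 < t := by positivity
  have hs : initialError P γ n (U ω) ≤ E * t ^ (1 + β) := by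
    have hG := h.integral_lossDiff_le h0 h1 hβ hδ (hd.trans hDδ)
    have hV : Real.sqrt (∫ x, lossDiff γ (U ω) θ₀ x ^ 2 ∂P) ≤ |U ω - θ₀| :=
      Real.sqrt_le_iff.mpr ⟨abs_nonneg _, by
        rw [sq_abs]; exact integral_lossDiff_sq_le h0 h1 _ _⟩
    calc initialError P γ n (U ω) ≤ t ^ β * (D * t) + (M₀ + M₁) * (D * t) ^ (1 + β) := by
          unfold initialError
          rw [ht, rpow_neg_half_mul_rpow hβ]
          refine add_le_add ?_ (hG.trans ?_)
          · exact mul_le_mul_of_nonneg_left (hV.trans hd) (by positivity)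
          · gcongr
      _ = _ := by
          rw [Real.mul_rpow hD ht0, hE, Real.rpow_add htpos, Real.rpow_one]
          ring
  have hs0 := h.initialError_nonneg h0 h1 hβ hδ n (U ω)
  have hq : localRadius P γ β K n (U ω) ≤ R * t := by
    have h3 := Real.rpow_le_rpow hs0 hs (one_div_pos.mpr hβ1).le
    rw [Real.mul_rpow hE0 (by positivity), ← Real.rpow_mul ht0,
      mul_one_div_cancel hβ1.ne', Real.rpow_one] at h3
    unfold localRadius
    calc _ ≤ K * (t + E ^ (1 / (1 + β)) * t) := by gcongr
      _ = _ := by rw [hR]; ring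
  have := ediam_le_of_forall_abs_sub_le fun θ hθ => (((hω θ hθ).1 (hq.trans hRδ)).trans hq)
  rwa [← mul_assoc] at this

/-! ### Width for a general initial estimator. -/

lemma measure_mul_lintegral_lt_le {Ω : Type*} [MeasurableSpace Ω] {μ : Measure Ω}
    {f : Ω → ENNReal} (hf : Measurable f) {A : ℝ} (hA : 0 < A) :
    μ {ω | ENNReal.ofReal A * ∫⁻ x, f x ∂μ < f ω} ≤ ENNReal.ofReal (1 / A) := by
  have hA0 : ENNReal.ofReal A ≠ 0 := by simpa using hA
  rcases eq_or_ne (∫⁻ x, f x ∂μ) 0 with h0 | h0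
  · rw [h0]
    refine le_of_eq_of_le (measure_mono_null (fun ω hω => ?_)
      (ae_iff.mp ((lintegral_eq_zero_iff hf).mp h0))) zero_le
    simp only [mul_zero, Set.mem_ofPred_eq] at hω
    exact hω.ne'
  rcases eq_or_ne (∫⁻ x, f x ∂μ) ⊤ with ht | ht
  · rw [ht, ENNReal.mul_top hA0]
    simp
  · calc _ ≤ μ {ω | ENNReal.ofReal A * ∫⁻ x, f x ∂μ ≤ f ω} :=
          measure_mono fun ω (hω : ENNReal.ofReal A * ∫⁻ x, f x ∂μ < f ω) => hω.le
      _ ≤ (∫⁻ x, f x ∂μ) / (ENNReal.ofReal A * ∫⁻ x, f x ∂μ) :=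
          meas_ge_le_lintegral_div hf.aemeasurable (mul_ne_zero hA0 h0)
            (ENNReal.mul_ne_top ENNReal.ofReal_ne_top ht)
      _ = _ := by
          rw [one_div, ENNReal.ofReal_inv_of_pos hA, ENNReal.div_eq_inv_mul,
            ENNReal.mul_inv (Or.inl hA0) (Or.inl ENNReal.ofReal_ne_top), mul_assoc,
            ENNReal.inv_mul_cancel h0 ht, mul_one]

theorem exists_width_le_widthBound (ε α β M₀ M₁ : ℝ) (hε : 0 < ε) (hβ : 0 < β) (hM : M₁ < M₀) :
    ∃ c > 0, ∃ C₁ > 0, ∃ C₂ > 0,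
      ∀ (γ δ : ℝ) (P : Measure ℝ) [IsProbabilityMeasure P],
        0 < γ → γ < 1 → 0 < δ → HolderAtQuantile P γ β δ M₀ M₁ →
      ∀ (Ω : Type*) [MeasurableSpace Ω] (μ : Measure Ω) [IsProbabilityMeasure μ]
        (N : ℕ) (X : Fin N → Ω → ℝ) (I : Finset (Fin N)) (U s : Ω → ℝ),
        IsIIDSample X P μ → Measurable U → IndepFun U (subsample X I) μ →
        (∀ᵐ ω ∂μ, initialError P γ I.card (U ω) ≤ s ω) →
        C₁ * δ ^ (-(2 * β)) ≤ (I.card : ℝ) →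
        1 - ε ≤ μ.real {ω | Metric.ediam (cltSet γ α (U ω) (subsample X I ω)) ≤
          ENNReal.ofReal c * widthBound μ U (quantile P γ) β δ C₂ I.card (s ω)} := by
  obtain ⟨K, hK, L, hL, C, hC, hloc⟩ :=
    exists_localization (ε / 2) α β M₀ M₁ (by linarith) hβ hM
  have hβ1 : 0 < 1 + β := by linarith
  -- `C₁` and `C₂` make each of the two terms of the local radius at most `δ / 2` when the initial
  -- estimator is near.
  set C₁ := max C ((2 * K) ^ (2 * β)) with hC₁
  have hC₁0 : 0 < C₁ := lt_max_of_lt_left hC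
  set C₂ := (2 * K) ^ (-(1 + β)) / 2 with hC₂
  have hC₂0 : 0 < C₂ := by positivity
  -- In the far case `δ` itself is at most `(1 / C₂) δ^{-β} |U - θ₀|`; the 2 passes from radius to
  -- diameter.
  set L' := 2 * max (1 / C₂) L with hL'
  have hL'0 : 0 < L' := mul_pos two_pos (lt_max_of_lt_right hL)
  set c := max (8 * K / ε) (L' * (4 / ε)) with hc
  have hc0 : 0 < c := lt_max_of_lt_left (by positivity)
  refine ⟨c, hc0, C₁, hC₁0, C₂, hC₂0, ?_⟩
  intro γ δ P _ h0 h1 hδ h Ω _ μ _ N X I U s hX hU hind hs hn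
  have hbad := hloc γ δ P h0 h1 hδ h Ω μ N X I U hX hU hind
    (le_trans (by gcongr; exact le_max_left _ _) hn)
  set n := I.card with hn'
  set θ₀ := quantile P γ with hθ₀
  set t := (n : ℝ) ^ (-(1 / (2 * β))) with ht
  have ht0 : 0 ≤ t := by positivity
  have hnpos : (0 : ℝ) < n := lt_of_lt_of_le (by positivity) hn
  have hn1 : 1 ≤ n := by exact_mod_cast hnpos
  set near : Set Ω := {ω | |U ω - θ₀| < C₂ * δ ^ (1 + β)} with hnear
  set far : Set Ω := {ω | C₂ * δ ^ (1 + β) ≤ |U ω - θ₀|} with hfar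
  have hfarm : MeasurableSet far :=
    measurableSet_le measurable_const ((hU.sub_const _).abs)
  set f : Ω → ENNReal := far.indicator fun ω => ENNReal.ofReal |U ω - θ₀| with hf
  have hfm : Measurable f := (hU.sub_const θ₀).abs.ennreal_ofReal.indicator hfarm
  have hmarkov : μ.real {ω | ENNReal.ofReal (4 / ε) * ∫⁻ x, f x ∂μ < f ω} ≤ ε / 4 := by
    refine ENNReal.toReal_le_of_le_ofReal (by positivity) ?_
    refine (measure_mul_lintegral_lt_le hfm (by positivity)).trans_eq ?_
    congr 1; field_simp
  -- If `near` has probability below `ε / 4` it is discarded; otherwise the factor `ℙ(near)` in the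
  -- width bound costs only `4 / ε`.
  have hrare : μ.real {ω | ω ∈ near ∧ μ.real near < ε / 4} ≤ ε / 4 := by
    by_cases hp : μ.real near < ε / 4
    · exact (measureReal_mono fun ω hω => hω.1).trans hp.le
    · simp only [hp, and_false]
      simp; positivity
  have hnull : μ.real {ω | ¬ initialError P γ n (U ω) ≤ s ω} ≤ 0 := by
    rw [measureReal_def, ae_iff.mp hs, ENNReal.toReal_zero]
  have hunion := (measureReal_union_le (μ := μ) _ _).trans
    (add_le_add ((measureReal_union_le (μ := μ) _ _).trans
      (add_le_add ((measureReal_union_le (μ := μ) _ _).trans (add_le_add hbad hmarkov)) hrare))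
      hnull)
  refine one_sub_le_measureReal (fun ω hω => ?_)
    (hunion.trans_eq (by ring : ε / 2 + ε / 4 + ε / 4 + 0 = ε))
  simp only [Set.mem_union, Set.mem_ofPred_eq, not_or, not_not, not_lt, not_and] at hω ⊢
  obtain ⟨⟨⟨hω, hfω⟩, hnω⟩, hsω⟩ := hω
  have hs0 := h.initialError_nonneg h0 h1 hβ hδ n (U ω)
  by_cases hmem : ω ∈ near
  · have hp := hnω hmem
    have hmem : |U ω - θ₀| < C₂ * δ ^ (1 + β) := hmem
    have hq : localRadius P γ β K n (U ω) ≤ δ := by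
      have h2K : 0 < 2 * K := by positivity
      have h3 : t ≤ (2 * K)⁻¹ * δ := by
        refine (rpow_neg_inv_two_mul_le hβ hδ hC₁0 hn).trans ?_
        gcongr
        calc C₁ ^ (-(1 / (2 * β))) ≤ ((2 * K) ^ (2 * β)) ^ (-(1 / (2 * β))) :=
              Real.rpow_le_rpow_of_nonpos (by positivity) (le_max_right _ _)
                (by simp; positivity)
          _ = _ := by
              rw [← Real.rpow_mul h2K.le, ← Real.rpow_neg_one]
              congr 1; field_simp
      have h4 : initialError P γ n (U ω) ^ (1 / (1 + β)) ≤ (2 * K)⁻¹ * δ := by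
        have h5 : initialError P γ n (U ω) ≤ ((2 * K)⁻¹ * δ) ^ (1 + β) := by
          have := initialError_le (P := P) h0 h1 hn1 (U ω)
          rw [Real.mul_rpow (by positivity) hδ.le, Real.inv_rpow h2K.le,
            ← Real.rpow_neg h2K.le]
          rw [hC₂] at hmem
          linarith
        calc _ ≤ (((2 * K)⁻¹ * δ) ^ (1 + β)) ^ (1 / (1 + β)) := by gcongr
          _ = _ := by
              rw [← Real.rpow_mul (by positivity), mul_one_div_cancel hβ1.ne', Real.rpow_one]
      unfold localRadius
      calc _ ≤ K * ((2 * K)⁻¹ * δ + (2 * K)⁻¹ * δ) := by gcongr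
        _ = δ := by field_simp; ring
    set Y := t + s ω ^ (1 / (1 + β)) with hY
    have hY0 : 0 ≤ Y := add_nonneg ht0 (Real.rpow_nonneg (hs0.trans hsω) _)
    have hqY : localRadius P γ β K n (U ω) ≤ K * Y := by
      unfold localRadius
      rw [hY]
      gcongr
    calc _ ≤ ENNReal.ofReal (2 * (K * Y)) :=
          ediam_le_of_forall_abs_sub_le fun θ hθ => ((hω θ hθ).1 hq).trans hqY
      _ ≤ ENNReal.ofReal (c * (Y * μ.real near)) := by
          refine ENNReal.ofReal_le_ofReal ?_
          calc 2 * (K * Y) = 8 * K / ε * (Y * (ε / 4)) := by field_simp; ring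
            _ ≤ _ := by gcongr; exact le_max_left _ _
      _ = ENNReal.ofReal c * (ENNReal.ofReal Y * μ near) := by
          rw [ENNReal.ofReal_mul hc0.le, ENNReal.ofReal_mul hY0, ofReal_measureReal]
      _ ≤ _ := by
          unfold widthBound
          gcongr
          exact le_self_add
  · have hmem : ω ∈ far := not_lt.mp (show ¬ |U ω - θ₀| < C₂ * δ ^ (1 + β) from hmem)
    have hd : C₂ * δ ^ (1 + β) ≤ |U ω - θ₀| := hmem
    have hfω' : ENNReal.ofReal |U ω - θ₀| ≤ ENNReal.ofReal (4 / ε) * ∫⁻ x, f x ∂μ := by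
      rwa [hf, Set.indicator_of_mem hmem] at hfω
    rw [hf, lintegral_indicator hfarm] at hfω'
    have hR : ∀ θ ∈ cltSet γ α (U ω) (subsample X I ω),
        |θ - θ₀| ≤ max (1 / C₂) L * (δ ^ (-β) * |U ω - θ₀|) := fun θ hθ => by
      refine (hω θ hθ).2.trans (max_le ?_ ?_)
      · calc δ = 1 / C₂ * (δ ^ (-β) * (C₂ * δ ^ (1 + β))) := by
              rw [Real.rpow_add hδ, Real.rpow_one, Real.rpow_neg hδ.le]
              field_simp
          _ ≤ _ := by gcongr; exact le_max_left _ _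
      · rw [mul_assoc]
        gcongr
        exact le_max_right _ _
    calc _ ≤ ENNReal.ofReal (2 * (max (1 / C₂) L * (δ ^ (-β) * |U ω - θ₀|))) :=
          ediam_le_of_forall_abs_sub_le hR
      _ = ENNReal.ofReal L' * (ENNReal.ofReal (δ ^ (-β)) * ENNReal.ofReal |U ω - θ₀|) := by
          rw [← mul_assoc, ← hL', ENNReal.ofReal_mul hL'0.le,
            ENNReal.ofReal_mul (p := δ ^ (-β)) (by positivity)]
      _ ≤ ENNReal.ofReal L' * (ENNReal.ofReal (δ ^ (-β)) *
            (ENNReal.ofReal (4 / ε) * ∫⁻ x in far, ENNReal.ofReal |U x - θ₀| ∂μ)) := by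
          gcongr
      _ = ENNReal.ofReal (L' * (4 / ε)) * (ENNReal.ofReal (δ ^ (-β)) *
            ∫⁻ x in far, ENNReal.ofReal |U x - θ₀| ∂μ) := by
          rw [ENNReal.ofReal_mul hL'0.le]; ring
      _ ≤ ENNReal.ofReal c * (ENNReal.ofReal (δ ^ (-β)) *
            ∫⁻ x in far, ENNReal.ofReal |U x - θ₀| ∂μ) := by
          gcongr; exact le_max_right _ _
      _ ≤ _ := by
          unfold widthBound
          gcongr
          exact le_add_self

/-! ### The sample quantile: measurability and rate. -/

section SampleQuantile

variable {ι : Type*} [Fintype ι] {x : ι → ℝ} {γ t : ℝ}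

lemma empMean_indicator_mono (x : ι → ℝ) :
    Monotone fun t => empMean x (Set.indicator (Set.Iic t) 1) := fun _ _ h =>
  empMean_mono fun _ => Set.indicator_le_indicator_of_subset (Set.Iic_subset_Iic.mpr h)
    (fun _ => zero_le_one) _

/-- Since `γ > 0`, the level set is bounded below by the smallest observation; otherwise `sInf`
would take its default value. -/
lemma sampleQuantile_le (h0 : 0 < γ) (h : γ ≤ empMean x (Set.indicator (Set.Iic t) 1)) :
    sampleQuantile γ x ≤ t := by
  refine csInf_le ?_ h
  obtain ⟨b, hb⟩ := (Set.finite_range x).bddBelow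
  refine ⟨b, fun s (hs : γ ≤ _) => ?_⟩
  by_contra! hlt
  have : empMean x (Set.indicator (Set.Iic s) 1) = 0 := by
    unfold empMean
    rw [Finset.sum_eq_zero fun i _ => Set.indicator_of_notMem ?_ _, zero_div]
    exact not_le.mpr (hlt.trans_le (hb ⟨i, rfl⟩))
  linarith

lemma exists_le_empMean_indicator (hι : 0 < Fintype.card ι) (h1 : γ < 1) (x : ι → ℝ) :
    {t | γ ≤ empMean x (Set.indicator (Set.Iic t) 1)}.Nonempty := by
  obtain ⟨b, hb⟩ := (Set.finite_range x).bddAbove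
  refine ⟨b, ?_⟩
  have : empMean x (Set.indicator (Set.Iic b) 1) = 1 := by
    unfold empMean
    have hx : ∀ i, (Set.Iic b).indicator (1 : ℝ → ℝ) (x i) = 1 := fun i =>
      Set.indicator_of_mem (s := Set.Iic b) (hb ⟨i, rfl⟩) 1
    have : (Fintype.card ι : ℝ) ≠ 0 := by positivity
    simp [hx, this]
  exact h1.le.trans_eq this.symm

lemma le_sampleQuantile (hι : 0 < Fintype.card ι) (h1 : γ < 1)
    (h : empMean x (Set.indicator (Set.Iic t) 1) < γ) : t ≤ sampleQuantile γ x := by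
  refine le_csInf (exists_le_empMean_indicator hι h1 x) fun s (hs : γ ≤ _) => ?_
  by_contra! hlt
  exact absurd (hs.trans (empMean_indicator_mono x hlt.le)) (not_le.mpr h)

lemma measurable_sampleQuantile (hι : 0 < Fintype.card ι) (h0 : 0 < γ) (h1 : γ < 1) :
    Measurable (sampleQuantile γ : (ι → ℝ) → ℝ) := by
  refine measurable_of_Iio fun t => ?_
  have heq : (sampleQuantile γ : (ι → ℝ) → ℝ) ⁻¹' Set.Iio t =
      ⋃ (q : ℚ) (_ : (q : ℝ) < t), {x | γ ≤ empMean x (Set.indicator (Set.Iic (q : ℝ)) 1)} := by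
    ext x
    simp only [Set.mem_preimage, Set.mem_Iio, Set.mem_iUnion, Set.mem_ofPred_eq, exists_prop]
    constructor
    · intro h
      obtain ⟨s, hs, hst⟩ := exists_lt_of_csInf_lt (exists_le_empMean_indicator hι h1 x) h
      obtain ⟨q, hsq, hqt⟩ := exists_rat_btwn hst
      exact ⟨q, hqt, le_trans hs (empMean_indicator_mono x hsq.le)⟩
    · rintro ⟨q, hqt, hq⟩
      exact (sampleQuantile_le h0 hq).trans_lt hqt
  rw [heq]
  refine MeasurableSet.iUnion fun q => MeasurableSet.iUnion fun _ => ?_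
  refine measurableSet_le measurable_const ?_
  unfold empMean
  refine Measurable.div_const (Finset.measurable_sum _ fun i _ => ?_) _
  exact (measurable_one.indicator measurableSet_Iic).comp (measurable_pi_apply i)

end SampleQuantile

lemma IsIIDSample.measureReal_empMean_indicator_deviation_le {Ω : Type*} [MeasurableSpace Ω]
    {μ : Measure Ω} [IsProbabilityMeasure μ] {N : ℕ} {X : Fin N → Ω → ℝ} {P : Measure ℝ}
    [IsProbabilityMeasure P] {I : Finset (Fin N)} (hX : IsIIDSample X P μ) (hI : 0 < I.card)
    (t : ℝ) {A : ℝ} (hA : 0 < A) :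
    μ.real {ω | A * (1 / I.card)
      < (empMean (subsample X I ω) (Set.indicator (Set.Iic t) 1) - cdf P t) ^ 2} ≤ 1 / A := by
  have hi : Integrable ((Set.Iic t).indicator (1 : ℝ → ℝ)) P :=
    (integrable_const (1 : ℝ)).indicator measurableSet_Iic
  have hsq : (fun x => (Set.Iic t).indicator (1 : ℝ → ℝ) x ^ 2) = (Set.Iic t).indicator 1 := by
    ext x
    by_cases hx : x ∈ Set.Iic t <;> simp [hx]
  have hint : ∫ x, (Set.Iic t).indicator (1 : ℝ → ℝ) x ∂P = cdf P t := by
    rw [integral_indicator_one measurableSet_Iic, cdf_eq_real]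
  have := hX.measureReal_empMean_deviation_le (v := 1) hI
    (measurable_one.indicator measurableSet_Iic) hi (by rwa [hsq]) hA
    (by rw [hsq, hint]; exact cdf_le_one P t)
  rwa [hint] at this

/-- At `θ₀ ± τ` the function `F` has moved from `γ` by at least `(M₀ - M₁) τ^β`, more than the
Chebyshev deviation, so the empirical distribution function crosses `γ` in between. -/
lemma exists_sampleQuantile_rate (ε β M₀ M₁ κ : ℝ) (hε : 0 < ε) (hβ : 0 < β) (hM : M₁ < M₀)
    (hκ : 0 < κ) :
    ∃ D > 0, ∀ (γ δ : ℝ) (P : Measure ℝ) [IsProbabilityMeasure P],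
      0 < γ → γ < 1 → HolderAtQuantile P γ β δ M₀ M₁ →
      ∀ (Ω : Type*) [MeasurableSpace Ω] (μ : Measure Ω) [IsProbabilityMeasure μ]
        (N : ℕ) (X : Fin N → Ω → ℝ) (I : Finset (Fin N)) (n : ℕ), IsIIDSample X P μ →
        0 < n → κ * n ≤ I.card → D * (n : ℝ) ^ (-(1 / (2 * β))) ≤ δ →
        μ.real {ω | ¬ |sampleQuantile γ (subsample X I ω) - quantile P γ|
          ≤ D * (n : ℝ) ^ (-(1 / (2 * β)))} ≤ ε := by
  have hM0 : 0 < M₀ - M₁ := by linarith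
  set A := 2 / ε with hA
  have hA0 : 0 < A := by positivity
  -- `A + 1` in place of `A` makes the gap strict, as the lower bracket requires.
  set D := ((A + 1) / (κ * (M₀ - M₁) ^ 2)) ^ (1 / (2 * β)) with hD
  have hD0 : 0 < D := by positivity
  have hDpow : (M₀ - M₁) ^ 2 * (D ^ β) ^ 2 = (A + 1) / κ := by
    rw [← Real.rpow_natCast (D ^ β), ← Real.rpow_mul hD0.le, hD, ← Real.rpow_mul (by positivity)]
    rw [show 1 / (2 * β) * (β * ((2 : ℕ) : ℝ)) = 1 by push_cast; field_simp, Real.rpow_one]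
    field_simp
  refine ⟨D, hD0, ?_⟩
  intro γ δ P _ h0 h1 h Ω _ μ _ N X I n hX hn hκn hDδ
  have hn0 : (0 : ℝ) < n := by exact_mod_cast hn
  have hI : (0 : ℝ) < I.card := lt_of_lt_of_le (by positivity) hκn
  have hI' : 0 < I.card := by exact_mod_cast hI
  have hcard : 0 < Fintype.card I := by rwa [Fintype.card_coe]
  set τ := D * (n : ℝ) ^ (-(1 / (2 * β))) with hτ
  have hτ0 : 0 < τ := by positivity
  have hδ : 0 < δ := hτ0.trans_le hDδ
  have hq := h.cdf_quantile h0 h1 hβ hδ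
  set θ₀ := quantile P γ with hθ₀
  have hgap : A * (1 / I.card) < ((M₀ - M₁) * τ ^ β) ^ 2 := by
    have h3 : ((M₀ - M₁) * τ ^ β) ^ 2 = (A + 1) / (κ * n) := by
      rw [hτ, Real.mul_rpow hD0.le (by positivity), rpow_neg_half_mul_rpow hβ, rpow_neg_half_eq,
        mul_pow, mul_pow, ← mul_assoc, hDpow, inv_pow, Real.sq_sqrt hn0.le]
      field_simp
    rw [h3, mul_one_div]
    calc A / I.card ≤ A / (κ * n) := by gcongr
      _ < _ := by gcongr; linarith
  have hgap0 : 0 ≤ (M₀ - M₁) * τ ^ β := by positivity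
  have hb := (measureReal_union_le (μ := μ) _ _).trans
    (add_le_add (hX.measureReal_empMean_indicator_deviation_le hI' (θ₀ + τ) hA0)
      (hX.measureReal_empMean_indicator_deviation_le hI' (θ₀ - τ) hA0))
  refine (measureReal_mono (fun ω => ?_)).trans (hb.trans_eq (by rw [hA]; field_simp; norm_num))
  contrapose
  simp only [Set.mem_union, Set.mem_ofPred_eq, not_or, not_lt, not_not]
  rintro ⟨hr, hl⟩
  have hr' := (abs_lt.mp (abs_lt_of_sq_lt_sq (hr.trans_lt hgap) hgap0)).1
  have hl' := (abs_lt.mp (abs_lt_of_sq_lt_sq (hl.trans_lt hgap) hgap0)).2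
  have hFr := (h.right hτ0 hDδ).1
  have hFl := (h.left hτ0 hDδ).1
  rw [hq] at hFr hFl
  have h3 := sampleQuantile_le (t := θ₀ + τ) h0
    (by linarith : γ ≤ empMean (subsample X I ω) (Set.indicator (Set.Iic (θ₀ + τ)) 1))
  have h4 := le_sampleQuantile (t := θ₀ - τ) hcard h1
    (by linarith : empMean (subsample X I ω) (Set.indicator (Set.Iic (θ₀ - τ)) 1) < γ)
  rw [abs_le]
  constructor <;> linarith

end QuantileCI

end

/-! ### The three width statements. -/

theorem mainTheorem12 (ε α β M₀ M₁ : ℝ) (hε : 0 < ε) (hα₀ : 0 < α) (hα₁ : α < 1)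
    (hβ : 0 < β) (hM₁ : 0 < M₁) (hM : M₁ < M₀) :
    -- width with a general initial estimator
    (∃ c > 0, ∃ C₁ > 0, ∃ C₂ > 0,
      ∀ (γ δ : ℝ) (P : Measure ℝ) [IsProbabilityMeasure P],
        0 < γ → γ < 1 → 0 < δ → QuantileCI.HolderAtQuantile P γ β δ M₀ M₁ →
      ∀ (Ω : Type*) [MeasurableSpace Ω] (μ : Measure Ω) [IsProbabilityMeasure μ]
        (N : ℕ) (X : Fin N → Ω → ℝ) (I₁ I₂ : Finset (Fin N)) (n : ℕ),
        QuantileCI.IsIIDSample X P μ → IsCompl I₁ I₂ → I₂.card = n →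
      ∀ (T : (I₁ → ℝ) → ℝ) (s : Ω → ℝ), Measurable T → Measurable s →
        (∀ᵐ ω ∂μ, QuantileCI.initialError P γ n (T (QuantileCI.subsample X I₁ ω)) ≤ s ω) →
        C₁ * δ ^ (-(2 * β)) ≤ (n : ℝ) →
        1 - ε ≤ μ.real {ω |
          Metric.ediam (QuantileCI.cltSet γ α (T (QuantileCI.subsample X I₁ ω))
              (QuantileCI.subsample X I₂ ω)) ≤
            ENNReal.ofReal c * QuantileCI.widthBound μ
              (fun ω' => T (QuantileCI.subsample X I₁ ω')) (QuantileCI.quantile P γ)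
              β δ C₂ n (s ω)}) ∧
    -- width when the initial estimator converges at the rate `n^{-1/(2β)}`
    (∀ C : ℝ → ℝ, ∃ c > 0, ∀ δ > 0, ∃ n₀ : ℕ,
      ∀ (γ : ℝ) (P : Measure ℝ) [IsProbabilityMeasure P],
        0 < γ → γ < 1 → QuantileCI.HolderAtQuantile P γ β δ M₀ M₁ →
      ∀ (Ω : Type*) [MeasurableSpace Ω] (μ : Measure Ω) [IsProbabilityMeasure μ]
        (N : ℕ) (X : Fin N → Ω → ℝ) (I₁ I₂ : Finset (Fin N)) (n : ℕ),
        QuantileCI.IsIIDSample X P μ → IsCompl I₁ I₂ → I₂.card = n →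
      ∀ T : (I₁ → ℝ) → ℝ, Measurable T →
        (∀ ε' > 0, 1 - ε' ≤ μ.real {ω |
          |T (QuantileCI.subsample X I₁ ω) - QuantileCI.quantile P γ| ^ 2 ≤
            C ε' * (n : ℝ) ^ (-(1 / β))}) →
        n₀ ≤ n →
        1 - ε ≤ μ.real {ω |
          Metric.ediam (QuantileCI.cltSet γ α (T (QuantileCI.subsample X I₁ ω))
              (QuantileCI.subsample X I₂ ω)) ≤
            ENNReal.ofReal (c * (n : ℝ) ^ (-(1 / (2 * β))))}) ∧
    -- width when the initial estimator is the sample quantile of the first part of the data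
    (∀ κ > 0, ∃ c > 0, ∀ δ > 0, ∃ n₀ : ℕ,
      ∀ (γ : ℝ) (P : Measure ℝ) [IsProbabilityMeasure P],
        0 < γ → γ < 1 → QuantileCI.HolderAtQuantile P γ β δ M₀ M₁ →
      ∀ (Ω : Type*) [MeasurableSpace Ω] (μ : Measure Ω) [IsProbabilityMeasure μ]
        (N : ℕ) (X : Fin N → Ω → ℝ) (I₁ I₂ : Finset (Fin N)) (n : ℕ),
        QuantileCI.IsIIDSample X P μ → IsCompl I₁ I₂ → I₂.card = n →
        κ * (n : ℝ) ≤ (I₁.card : ℝ) → n₀ ≤ n →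
        1 - ε ≤ μ.real {ω |
          Metric.ediam (QuantileCI.cltSet γ α
              (QuantileCI.sampleQuantile γ (QuantileCI.subsample X I₁ ω))
              (QuantileCI.subsample X I₂ ω)) ≤
            ENNReal.ofReal (c * (n : ℝ) ^ (-(1 / (2 * β))))}) := by
  refine ⟨?_, fun C => ?_, fun κ hκ => ?_⟩
  · obtain ⟨c, hc, C₁, hC₁, C₂, hC₂, h⟩ :=
      QuantileCI.exists_width_le_widthBound ε α β M₀ M₁ hε hβ hM
    refine ⟨c, hc, C₁, hC₁, C₂, hC₂, ?_⟩
    rintro γ δ P _ h0 h1 hδ hP Ω _ μ _ N X I₁ I₂ _ hX hI rfl T s hT _ hs hn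
    exact h γ δ P h0 h1 hδ hP Ω μ N X I₂ _ s hX (hT.comp (hX.measurable_subsample I₁))
      ((hX.indepFun_subsample hI.disjoint).comp hT measurable_id) hs hn
  -- Only the value of `C` at `ε / 2` matters; if it is negative the square root is 0.
  · obtain ⟨c, hc, h⟩ := QuantileCI.exists_width_of_rate ε α β M₀ M₁ (Real.sqrt (C (ε / 2)))
      hε hβ hM₁ hM (Real.sqrt_nonneg _)
    refine ⟨c, hc, fun δ hδ => ?_⟩
    obtain ⟨n₀, hn₀⟩ := h δ hδ
    refine ⟨n₀, ?_⟩
    rintro γ P _ h0 h1 hP Ω _ μ _ N X I₁ I₂ _ hX hI rfl T hT hrate hn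
    have hU := hT.comp (hX.measurable_subsample I₁)
    refine hn₀ γ P h0 h1 hP Ω μ N X I₂ _ hX hU
      ((hX.indepFun_subsample hI.disjoint).comp hT measurable_id) ?_ hn
    have hr := hrate (ε / 2) (half_pos hε)
    have hpow : (I₂.card : ℝ) ^ (-(1 / β)) = ((I₂.card : ℝ) ^ (-(1 / (2 * β)))) ^ 2 := by
      rw [← Real.rpow_natCast, ← Real.rpow_mul (by positivity)]
      congr 1
      push_cast
      field_simp
    have hmeas : MeasurableSet {ω | |T (QuantileCI.subsample X I₁ ω) - QuantileCI.quantile P γ|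
        ≤ Real.sqrt (C (ε / 2)) * (I₂.card : ℝ) ^ (-(1 / (2 * β)))} :=
      measurableSet_le (hU.sub_const _).abs measurable_const
    have hsub := measureReal_mono (μ := μ) (fun ω (hω :
        |T (QuantileCI.subsample X I₁ ω) - QuantileCI.quantile P γ| ^ 2 ≤
          C (ε / 2) * (I₂.card : ℝ) ^ (-(1 / β))) =>
      show |T (QuantileCI.subsample X I₁ ω) - QuantileCI.quantile P γ|
        ≤ Real.sqrt (C (ε / 2)) * (I₂.card : ℝ) ^ (-(1 / (2 * β))) by
        rw [hpow] at hω
        have h3 := Real.sqrt_le_sqrt hω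
        rwa [Real.sqrt_sq (abs_nonneg _), Real.sqrt_mul' _ (sq_nonneg _),
          Real.sqrt_sq (by positivity)] at h3)
    have hcompl := probReal_compl_eq_one_sub (μ := μ) hmeas
    change μ.real {ω | |T (QuantileCI.subsample X I₁ ω) - QuantileCI.quantile P γ|
        ≤ Real.sqrt (C (ε / 2)) * (I₂.card : ℝ) ^ (-(1 / (2 * β)))}ᶜ ≤ ε / 2
    rw [hcompl]
    exact sub_le_comm.mp (hr.trans hsub)
  · obtain ⟨D, hD, hrate⟩ := QuantileCI.exists_sampleQuantile_rate (ε / 2) β M₀ M₁ κ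
      (half_pos hε) hβ hM hκ
    obtain ⟨c, hc, h⟩ := QuantileCI.exists_width_of_rate ε α β M₀ M₁ D hε hβ hM₁ hM hD.le
    refine ⟨c, hc, fun δ hδ => ?_⟩
    obtain ⟨n₀, hn₀⟩ := h δ hδ
    obtain ⟨n₁, hn₁⟩ := Filter.eventually_atTop.mp
      (QuantileCI.eventually_mul_rpow_neg_le hβ D hδ)
    -- The 1 makes `n`, hence `|D₁|`, positive, so that the sample quantile is measurable.
    refine ⟨max (max n₀ n₁) 1, ?_⟩
    rintro γ P _ h0 h1 hP Ω _ μ _ N X I₁ I₂ _ hX hI rfl hκn hn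
    obtain ⟨⟨hna, hnb⟩, hn⟩ : (n₀ ≤ I₂.card ∧ n₁ ≤ I₂.card) ∧ 1 ≤ I₂.card := by
      simpa only [max_le_iff] using hn
    have hI₁ : 0 < Fintype.card I₁ := by
      have : (0 : ℝ) < I₁.card :=
        lt_of_lt_of_le (mul_pos hκ (by exact_mod_cast hn)) hκn
      rw [Fintype.card_coe]
      exact_mod_cast this
    have hT := QuantileCI.measurable_sampleQuantile hI₁ h0 h1
    exact hn₀ γ P h0 h1 hP Ω μ N X I₂ _ hX (hT.comp (hX.measurable_subsample I₁))
      ((hX.indepFun_subsample hI.disjoint).comp hT measurable_id)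
      (hrate γ δ P h0 h1 hP Ω μ N X I₁ _ hX hn hκn (hn₁ _ hnb)) hna
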